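/- Let $m\ge 2$, let $\theta=(\theta_{ij})$ be a real skew-symmetric $m\times m$ matrix, and put $\rho_{ij}=\exp(2\pi i\,\theta_{ij})$. Let $C(S^{2m-1}_\theta)$ be the universal unital C*-algebra generated by $m$ normal elements $z_1,\dots,z_m$ subject to $$z_1z_1^*+\dots+z_mz_m^*=1,\qquad z_iz_j=\rho_{ji}\,z_jz_i\quad(1\le i,j\le m),$$ and let $C(D^{2m}_\theta)$ be the universal unital C*-algebra generated by $m$ normal elements $w_1,\dots,w_m$ and a positive element $y$ subject to $$w_1w_1^*+\dots+w_mw_m^*+y^2=1,\qquad w_iw_j=\rho_{ji}\,w_jw_i,\qquad yw_i=w_iy\quad(1\le i,j\le m).$$ Then there are isomorphisms of C*-algebras $$C(D^{2m}_\theta)\;\cong\;\{f\in C([0,1],C(S^{2m-1}_\theta)) : f(1)\in\mathbb C\cdot 1\}\;\cong\;\bigl(C_0([0,1))\otimes C(S^{2m-1}_\theta)\bigr)^{\sim},$$ where $\otimes$ denotes the C*-tensor product (the C*-norm on the algebraic tensor product is unique because $C_0([0,1))$ is commutative, hence nuclear) and $A^\sim$ denotes the unitization of a non-unital C*-algebra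 $A$. -/

import Mathlib

open scoped ZeroAtInfty

noncomputable section

universe u

namespace NCBall

/-! ### The free unital `*`-algebra on a set -/

/-- The free unital complex `*`-algebra on a set `X`: the free algebra on the letters
`x = Sum.inl x` and their formal adjoints `x⋆ = Sum.inr x`. -/
def FreeStarAlgebra (X : Type u) : Type u := FreeAlgebra ℂ (X ⊕ X)

namespace FreeStarAlgebra

variable {X : Type u}

instance : Ring (FreeStarAlgebra X) := inferInstanceAs (Ring (FreeAlgebra ℂ (X ⊕ X)))

instance : Algebra ℂ (FreeStarAlgebra X) :=
  inferInstanceAs (Algebra ℂ (FreeAlgebra ℂ (X ⊕ X)))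

/-- The letters (`inl x` is the generator `x`, `inr x` is its formal adjoint). -/
def letter (s : X ⊕ X) : FreeStarAlgebra X := FreeAlgebra.ι ℂ s

theorem induction {C : FreeStarAlgebra X → Prop}
    (h_scalar : ∀ r : ℂ, C (algebraMap ℂ _ r)) (h_letter : ∀ s, C (letter s))
    (h_mul : ∀ a b, C a → C b → C (a * b)) (h_add : ∀ a b, C a → C b → C (a + b))
    (a : FreeStarAlgebra X) : C a :=
  FreeAlgebra.induction ℂ (X ⊕ X) h_scalar h_letter h_mul h_add a

/-- The involution, as a ring homomorphism to the opposite ring: it exchanges `x` and `x⋆`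
and conjugates scalars. -/
def starHom : FreeStarAlgebra X →+* (FreeStarAlgebra X)ᵐᵒᵖ :=
  letI : Algebra ℂ (FreeStarAlgebra X)ᵐᵒᵖ :=
    Algebra.compHom (FreeStarAlgebra X)ᵐᵒᵖ (starRingEnd ℂ)
  (FreeAlgebra.lift ℂ (fun s : X ⊕ X => MulOpposite.op (letter s.swap)) :
    FreeAlgebra ℂ (X ⊕ X) →ₐ[ℂ] (FreeStarAlgebra X)ᵐᵒᵖ).toRingHom

theorem starHom_letter (s : X ⊕ X) : starHom (letter s) = MulOpposite.op (letter s.swap) := by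
  let _ : Algebra ℂ (FreeStarAlgebra X)ᵐᵒᵖ :=
    Algebra.compHom (FreeStarAlgebra X)ᵐᵒᵖ (starRingEnd ℂ)
  exact FreeAlgebra.lift_ι_apply (R := ℂ) (fun s : X ⊕ X => MulOpposite.op (letter s.swap)) s

theorem starHom_algebraMap (r : ℂ) :
    starHom (algebraMap ℂ (FreeStarAlgebra X) r) =
      MulOpposite.op (algebraMap ℂ (FreeStarAlgebra X) (starRingEnd ℂ r)) := by
  let _ : Algebra ℂ (FreeStarAlgebra X)ᵐᵒᵖ :=
    Algebra.compHom (FreeStarAlgebra X)ᵐᵒᵖ (starRingEnd ℂ)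
  exact (FreeAlgebra.lift ℂ (fun s : X ⊕ X => MulOpposite.op (letter s.swap)) :
    FreeAlgebra ℂ (X ⊕ X) →ₐ[ℂ] (FreeStarAlgebra X)ᵐᵒᵖ).commutes r

instance : StarRing (FreeStarAlgebra X) where
  star a := (starHom a).unop
  star_involutive a := by
    induction a using induction with
    | h_scalar r => simp [starHom_algebraMap]
    | h_letter s => simp [starHom_letter]
    | h_mul a b ha hb => simp [ha, hb]
    | h_add a b ha hb => simp [ha, hb]
  star_mul a b := by simp
  star_add a b := by simp

theorem star_letter (s : X ⊕ X) : star (letter s) = letter s.swap := by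
  change (starHom (letter s)).unop = _
  simp [starHom_letter]

theorem star_algebraMap (r : ℂ) :
    star (algebraMap ℂ (FreeStarAlgebra X) r) = algebraMap ℂ _ (star r) := by
  change (starHom _).unop = _
  simp [starHom_algebraMap]

instance : StarModule ℂ (FreeStarAlgebra X) where
  star_smul r a := by
    rw [Algebra.smul_def, star_mul, star_algebraMap, Algebra.smul_def, Algebra.commutes]

/-- Evaluation of `*`-polynomials at a family of elements of a C⋆-algebra. -/
def eval {B : Type*} [CStarAlgebra B] (f : X → B) : FreeStarAlgebra X →ₐ[ℂ] B :=
  (FreeAlgebra.lift ℂ (Sum.elim f (fun x => star (f x))) : FreeAlgebra ℂ (X ⊕ X) →ₐ[ℂ] B)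

theorem eval_letter {B : Type*} [CStarAlgebra B] (f : X → B) (s : X ⊕ X) :
    eval f (letter s) = Sum.elim f (fun x => star (f x)) s :=
  FreeAlgebra.lift_ι_apply (R := ℂ) _ s

theorem eval_star {B : Type*} [CStarAlgebra B] (f : X → B) (a : FreeStarAlgebra X) :
    eval f (star a) = star (eval f a) := by
  induction a using induction with
  | h_scalar r => rw [star_algebraMap, AlgHom.commutes, AlgHom.commutes, algebraMap_star_comm]
  | h_letter s => cases s <;> simp [star_letter, eval_letter]
  | h_mul a b ha hb => simp [ha, hb]
  | h_add a b ha hb => simp [ha, hb]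

end FreeStarAlgebra

/-! ### Universal C⋆-algebras -/

/-- A set `X` of generators together with admissible relations for families indexed by `X` in
unital C⋆-algebras; the relations bound the norm of every generator. It suffices to consider
C⋆-algebras in the universe of `X`, since the C⋆-subalgebra generated by an `X`-indexed family has
a copy in that universe. -/
structure Presentation (X : Type u) where
  /-- `Holds f` says that the family `f` satisfies the relations. -/
  Holds : ∀ {B : Type u} [CStarAlgebra B], (X → B) → Prop
  bound : X → ℝ
  norm_le : ∀ {B : Type u} [CStarAlgebra B] (f : X → B), Holds f → ∀ x, ‖f x‖ ≤ bound x

variable {X : Type u}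

/-- The free `*`-algebra on `X`, to be given the seminorm determined by the relations `P`. -/
def PreUniversal (_P : Presentation X) : Type u := FreeStarAlgebra X

namespace PreUniversal

variable (P : Presentation X)

instance : Ring (PreUniversal P) := inferInstanceAs (Ring (FreeStarAlgebra X))
instance : Algebra ℂ (PreUniversal P) := inferInstanceAs (Algebra ℂ (FreeStarAlgebra X))
instance : StarRing (PreUniversal P) := inferInstanceAs (StarRing (FreeStarAlgebra X))
instance : StarModule ℂ (PreUniversal P) := inferInstanceAs (StarModule ℂ (FreeStarAlgebra X))

variable {P}

/-- Evaluation of `*`-polynomials. -/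
def eval {B : Type*} [CStarAlgebra B] (f : X → B) : PreUniversal P →ₐ[ℂ] B :=
  FreeStarAlgebra.eval f

theorem eval_star {B : Type*} [CStarAlgebra B] (f : X → B) (a : PreUniversal P) :
    eval f (star a) = star (eval f a) :=
  FreeStarAlgebra.eval_star f a

/-- The norms of the values of a `*`-polynomial at all families satisfying the relations. -/
def values (a : PreUniversal P) : Set ℝ :=
  {r | ∃ (B : Type u) (_ : CStarAlgebra B) (f : X → B), P.Holds f ∧ r = ‖eval (P := P) f a‖}

theorem norm_one_le_one (B : Type*) [CStarAlgebra B] : ‖(1 : B)‖ ≤ 1 := by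
  rcases subsingleton_or_nontrivial B with h | h
  · rw [Subsingleton.elim (1 : B) 0]; simp
  · exact (CStarRing.norm_one).le

theorem bddAbove_values (a : PreUniversal P) : BddAbove (values a) := by
  suffices h : ∃ C : ℝ, 0 ≤ C ∧ ∀ (B : Type u) (_ : CStarAlgebra B) (f : X → B), P.Holds f →
      ‖eval (P := P) f a‖ ≤ C by
    obtain ⟨C, -, hC⟩ := h
    refine ⟨C, ?_⟩
    rintro r ⟨B, hB, f, hf, rfl⟩
    exact hC B hB f hf
  refine FreeStarAlgebra.induction (C := fun a : FreeStarAlgebra X =>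
    ∃ C : ℝ, 0 ≤ C ∧ ∀ (B : Type u) (_ : CStarAlgebra B) (f : X → B), P.Holds f →
      ‖FreeStarAlgebra.eval f a‖ ≤ C) ?_ ?_ ?_ ?_ a
  · intro r
    refine ⟨‖r‖, norm_nonneg _, fun B hB f _ => ?_⟩
    rw [AlgHom.commutes, Algebra.algebraMap_eq_smul_one, norm_smul]
    exact mul_le_of_le_one_right (norm_nonneg _) (norm_one_le_one B)
  · intro s
    refine ⟨|P.bound (s.elim id id)|, abs_nonneg _, fun B hB f hf => ?_⟩
    rw [FreeStarAlgebra.eval_letter]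
    cases s with
    | inl x => exact (P.norm_le f hf x).trans (le_abs_self _)
    | inr x => simpa using (P.norm_le f hf x).trans (le_abs_self _)
  · rintro a b ⟨C, hC, h⟩ ⟨C', hC', h'⟩
    refine ⟨C * C', mul_nonneg hC hC', fun B hB f hf => ?_⟩
    rw [map_mul]
    exact (norm_mul_le _ _).trans
      (mul_le_mul (h B hB f hf) (h' B hB f hf) (norm_nonneg _) hC)
  · rintro a b ⟨C, hC, h⟩ ⟨C', hC', h'⟩
    refine ⟨C + C', add_nonneg hC hC', fun B hB f hf => ?_⟩
    rw [map_add]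
    exact (norm_add_le _ _).trans (add_le_add (h B hB f hf) (h' B hB f hf))

/-- The universal C⋆-seminorm: the supremum of the norms in all C⋆-algebras, over all families
satisfying the relations. -/
def supNorm (a : PreUniversal P) : ℝ := sSup (values a)

theorem le_supNorm {B : Type u} [CStarAlgebra B] (f : X → B) (hf : P.Holds f)
    (a : PreUniversal P) : ‖eval (P := P) f a‖ ≤ supNorm a :=
  le_csSup (bddAbove_values a) ⟨B, inferInstance, f, hf, rfl⟩

theorem supNorm_nonneg (a : PreUniversal P) : 0 ≤ supNorm a := by
  apply Real.sSup_nonneg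
  rintro r ⟨B, hB, f, hf, rfl⟩
  exact norm_nonneg _

theorem supNorm_le {a : PreUniversal P} {C : ℝ} (hC : 0 ≤ C)
    (h : ∀ (B : Type u) [CStarAlgebra B] (f : X → B), P.Holds f →
      ‖eval (P := P) f a‖ ≤ C) : supNorm a ≤ C := by
  apply Real.sSup_le _ hC
  rintro r ⟨B, hB, f, hf, rfl⟩
  exact h B f hf

variable (P) in
/-- The universal seminorm as a ring seminorm. -/
def ringSeminorm : RingSeminorm (PreUniversal P) where
  toFun := supNorm
  map_zero' := le_antisymm (supNorm_le le_rfl fun B _ f _ => by simp) (supNorm_nonneg _)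
  add_le' a b := supNorm_le (add_nonneg (supNorm_nonneg _) (supNorm_nonneg _))
    fun B _ f hf => by
      rw [map_add]
      exact (norm_add_le _ _).trans (add_le_add (le_supNorm f hf a) (le_supNorm f hf b))
  neg' a := by
    apply le_antisymm
    · exact supNorm_le (supNorm_nonneg _) fun B _ f hf => by
        rw [map_neg, norm_neg]; exact le_supNorm f hf a
    · exact supNorm_le (supNorm_nonneg _) fun B _ f hf => by
        have := le_supNorm f hf (-a)
        rwa [map_neg, norm_neg] at this
  mul_le' a b := supNorm_le (mul_nonneg (supNorm_nonneg _) (supNorm_nonneg _))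
    fun B _ f hf => by
      rw [map_mul]
      exact (norm_mul_le _ _).trans (mul_le_mul (le_supNorm f hf a) (le_supNorm f hf b)
        (norm_nonneg _) (supNorm_nonneg _))

instance : SeminormedRing (PreUniversal P) := (ringSeminorm P).toSeminormedRing

theorem norm_def (a : PreUniversal P) : ‖a‖ = supNorm a := rfl

instance : NormedAlgebra ℂ (PreUniversal P) where
  norm_smul_le r a := supNorm_le (mul_nonneg (norm_nonneg _) (supNorm_nonneg _))
    fun B _ f hf => by
      rw [map_smul, norm_smul]
      exact mul_le_mul_of_nonneg_left (le_supNorm f hf a) (norm_nonneg _)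

instance : NormedStarGroup (PreUniversal P) where
  norm_star_le a := supNorm_le (supNorm_nonneg _) fun B _ f hf => by
    rw [eval_star, norm_star]; exact le_supNorm f hf a

theorem norm_mul_self_le (a : PreUniversal P) : ‖a‖ * ‖a‖ ≤ ‖star a * a‖ := by
  have h : ‖a‖ ≤ Real.sqrt ‖star a * a‖ := supNorm_le (Real.sqrt_nonneg _) fun B _ f hf => by
    apply Real.le_sqrt_of_sq_le
    have := le_supNorm f hf (star a * a)
    rw [map_mul, eval_star, CStarRing.norm_star_mul_self] at this
    rw [pow_two]
    exact this
  calc ‖a‖ * ‖a‖ ≤ Real.sqrt ‖star a * a‖ * Real.sqrt ‖star a * a‖ :=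
        mul_self_le_mul_self (norm_nonneg _) h
    _ = ‖star a * a‖ := Real.mul_self_sqrt (norm_nonneg _)

end PreUniversal

open UniformSpace in
/-- The universal unital C⋆-algebra generated by `X` subject to the relations `P`: the (Hausdorff)
completion of the free `*`-algebra in the universal C⋆-seminorm. -/
def UniversalCStarAlgebra (P : Presentation X) : Type u := Completion (PreUniversal P)

namespace UniversalCStarAlgebra

open UniformSpace

variable (P : Presentation X)

instance : NormedRing (UniversalCStarAlgebra P) :=
  inferInstanceAs (NormedRing (Completion (PreUniversal P)))

instance : CompleteSpace (UniversalCStarAlgebra P) :=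
  inferInstanceAs (CompleteSpace (Completion (PreUniversal P)))

instance : Algebra ℂ (UniversalCStarAlgebra P) :=
  inferInstanceAs (Algebra ℂ (Completion (PreUniversal P)))

/-- The canonical map from `*`-polynomials to the universal C⋆-algebra. -/
def coe (a : PreUniversal P) : UniversalCStarAlgebra P := (a : Completion (PreUniversal P))

variable {P}

theorem coe_add (a b : PreUniversal P) : coe P (a + b) = coe P a + coe P b :=
  Completion.coe_add a b

theorem coe_mul (a b : PreUniversal P) : coe P (a * b) = coe P a * coe P b :=
  Completion.coe_mul a b

theorem coe_smul (r : ℂ) (a : PreUniversal P) : coe P (r • a) = r • coe P a :=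
  Completion.coe_smul r a

theorem norm_coe (a : PreUniversal P) : ‖coe P a‖ = ‖a‖ := Completion.norm_coe a

theorem denseRange_coe : DenseRange (coe P) := Completion.denseRange_coe

theorem continuous_coe : Continuous (coe P) := Completion.continuous_coe _

instance : NormedAlgebra ℂ (UniversalCStarAlgebra P) where
  norm_smul_le r x := norm_smul_le (β := Completion (PreUniversal P)) r x

instance : Star (UniversalCStarAlgebra P) where
  star := Completion.map (star : PreUniversal P → PreUniversal P)

theorem uniformContinuous_star_pre :
    UniformContinuous (star : PreUniversal P → PreUniversal P) :=
  (starNormedAddGroupHom : NormedAddGroupHom (PreUniversal P) (PreUniversal P)).uniformContinuous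

theorem coe_star (a : PreUniversal P) : coe P (star a) = star (coe P a) :=
  (Completion.map_coe uniformContinuous_star_pre a).symm

theorem continuous_star' :
    Continuous (star : UniversalCStarAlgebra P → UniversalCStarAlgebra P) :=
  Completion.continuous_map

instance : StarRing (UniversalCStarAlgebra P) where
  star_involutive x := by
    refine denseRange_coe.induction_on x
      (isClosed_eq (continuous_star'.comp continuous_star') continuous_id) fun a => ?_
    rw [← coe_star, ← coe_star, star_star]
  star_mul x y := by
    refine denseRange_coe.induction_on₂
      (p := fun x y : UniversalCStarAlgebra P => star (x * y) = star y * star x)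
      (isClosed_eq (continuous_star'.comp (continuous_fst.mul continuous_snd))
        ((continuous_star'.comp continuous_snd).mul (continuous_star'.comp continuous_fst)))
      (fun a b => ?_) x y
    rw [← coe_mul, ← coe_star, star_mul, coe_mul, coe_star, coe_star]
  star_add x y := by
    refine denseRange_coe.induction_on₂
      (p := fun x y : UniversalCStarAlgebra P => star (x + y) = star x + star y)
      (isClosed_eq (continuous_star'.comp (continuous_fst.add continuous_snd))
        ((continuous_star'.comp continuous_fst).add (continuous_star'.comp continuous_snd)))
      (fun a b => ?_) x y
    rw [← coe_add, ← coe_star, star_add, coe_add, coe_star, coe_star]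

instance : CStarAlgebra (UniversalCStarAlgebra P) where
  norm_mul_self_le x := by
    refine denseRange_coe.induction_on x
      (isClosed_le (continuous_norm.mul continuous_norm)
        (continuous_norm.comp (continuous_star'.mul continuous_id))) fun a => ?_
    change ‖coe P a‖ * ‖coe P a‖ ≤ ‖star (coe P a) * coe P a‖
    rw [← coe_star, ← coe_mul, norm_coe, norm_coe]
    exact PreUniversal.norm_mul_self_le a
  star_smul r x := by
    refine denseRange_coe.induction_on x
      (isClosed_eq (continuous_star'.comp (continuous_const_smul r))
        (continuous_star'.const_smul (star r))) fun a => ?_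
    rw [← coe_smul, ← coe_star, star_smul, coe_smul, coe_star]

variable (P) in
/-- The canonical generators of the universal C⋆-algebra. -/
def gen (x : X) : UniversalCStarAlgebra P := coe P (FreeStarAlgebra.letter (Sum.inl x))

end UniversalCStarAlgebra

/-! ### Deformed spheres and balls -/

/-- In a C⋆-algebra, a summand `a * star a` of a sum of positive elements equal to `1` has
`‖a‖ ≤ 1`. -/
theorem norm_le_one_of_add_eq_one {B : Type*} [CStarAlgebra B] {ι : Type*} (s : Finset ι)
    (a : ι → B) (h : ∑ i ∈ s, a i * star (a i) = 1) (i : ι) (hi : i ∈ s) : ‖a i‖ ≤ 1 := by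
  let _ := CStarAlgebra.spectralOrder B
  have _ := CStarAlgebra.spectralOrderedRing B
  have h1 : a i * star (a i) ≤ 1 := by
    rw [← h]
    exact Finset.single_le_sum (f := fun i => a i * star (a i))
      (fun j _ => mul_star_self_nonneg (a j)) hi
  have h2 := (CStarAlgebra.norm_le_norm_of_nonneg_of_le (mul_star_self_nonneg (a i)) h1).trans
    (PreUniversal.norm_one_le_one B)
  rw [CStarRing.norm_self_mul_star] at h2
  nlinarith [norm_nonneg (a i)]

/-- `ρ i j = exp (2 π i θ i j)`. -/
def rho {m : ℕ} (θ : Matrix (Fin m) (Fin m) ℝ) (i j : Fin m) : ℂ :=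
  Complex.exp (2 * Real.pi * Complex.I * (θ i j : ℂ))

/-- The relations of the `θ`-deformed `(2m-1)`-sphere. -/
structure SphereRel {m : ℕ} (θ : Matrix (Fin m) (Fin m) ℝ) {B : Type*} [CStarAlgebra B]
    (z : Fin m → B) : Prop where
  normal : ∀ i, IsStarNormal (z i)
  sum_eq_one : ∑ i, z i * star (z i) = 1
  mul_eq : ∀ i j, z i * z j = rho θ j i • (z j * z i)

/-- The relations of the `θ`-deformed `2m`-ball; positivity of `y` means `y = b⋆b` for
some `b`. -/
structure BallRel {m : ℕ} (θ : Matrix (Fin m) (Fin m) ℝ) {B : Type*} [CStarAlgebra B]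
    (w : Fin m → B) (y : B) : Prop where
  normal : ∀ i, IsStarNormal (w i)
  positive : ∃ b : B, y = star b * b
  sum_eq_one : ∑ i, w i * star (w i) + y ^ 2 = 1
  mul_eq : ∀ i j, w i * w j = rho θ j i • (w j * w i)
  comm : ∀ i, y * w i = w i * y

/-- Presentation of `C(S^{2m-1}_θ)`: generators `z₁, …, z_m`. -/
def spherePresentation {m : ℕ} (θ : Matrix (Fin m) (Fin m) ℝ) : Presentation (Fin m) where
  Holds z := SphereRel θ z
  bound _ := 1
  norm_le z hz i := norm_le_one_of_add_eq_one Finset.univ z hz.sum_eq_one i (Finset.mem_univ i)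

/-- Presentation of `C(D^{2m}_θ)`: generators `w i = f (some i)` and `y = f none`. -/
def ballPresentation {m : ℕ} (θ : Matrix (Fin m) (Fin m) ℝ) :
    Presentation (Option (Fin m)) where
  Holds f := BallRel θ (fun i => f (some i)) (f none)
  bound _ := 1
  norm_le f hf i := by
    refine norm_le_one_of_add_eq_one Finset.univ f ?_ i (Finset.mem_univ i)
    obtain ⟨b, hb⟩ := hf.positive
    have hy : star (f none) = f none := by rw [hb]; simp
    rw [Fintype.sum_option, hy, ← pow_two, add_comm]
    exact hf.sum_eq_one

/-- The `θ`-deformed sphere `C(S^{2m-1}_θ)`. -/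
abbrev DeformedSphere {m : ℕ} (θ : Matrix (Fin m) (Fin m) ℝ) : Type :=
  UniversalCStarAlgebra (spherePresentation θ)

/-- The `θ`-deformed ball `C(D^{2m}_θ)`. -/
abbrev DeformedBall {m : ℕ} (θ : Matrix (Fin m) (Fin m) ℝ) : Type :=
  UniversalCStarAlgebra (ballPresentation θ)

/-! ### The cone and the tensor product -/

/-- The C⋆-algebra `{f ∈ C([0,1], A) : f(1) ∈ ℂ·1}`. -/
def cone (A : Type*) [CStarAlgebra A] : StarSubalgebra ℂ C(unitInterval, A) where
  carrier := {f | ∃ c : ℂ, f 1 = algebraMap ℂ A c}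
  mul_mem' := by
    rintro f g ⟨c, hc⟩ ⟨d, hd⟩
    exact ⟨c * d, by simp [hc, hd]⟩
  add_mem' := by
    rintro f g ⟨c, hc⟩ ⟨d, hd⟩
    exact ⟨c + d, by simp [hc, hd]⟩
  algebraMap_mem' c := ⟨c, rfl⟩
  star_mem' := by
    rintro f ⟨c, hc⟩
    exact ⟨star c, by rw [ContinuousMap.star_apply, hc, algebraMap_star_comm]⟩

variable (A B : Type u) [NonUnitalCStarAlgebra A] [NonUnitalCStarAlgebra B]

/-- The relations saying that a family indexed by `A ⊕ B` consists of a `*`-homomorphism on `A`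
and a `*`-homomorphism on `B` with commuting ranges. -/
def commutingPairPresentation : Presentation (A ⊕ B) where
  Holds {C} _ f := ∃ (φ : A →⋆ₙₐ[ℂ] C) (ψ : B →⋆ₙₐ[ℂ] C),
    (∀ a b, Commute (φ a) (ψ b)) ∧ f = Sum.elim φ ψ
  bound := Sum.elim (fun a => ‖a‖) (fun b => ‖b‖)
  norm_le := by
    rintro C _ f ⟨φ, ψ, -, rfl⟩ (a | b)
    · exact NonUnitalStarAlgHom.norm_apply_le φ a
    · exact NonUnitalStarAlgHom.norm_apply_le ψ b

/-- The product of the canonical images of `a` and `b` in the universal C⋆-algebra generated by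
commuting copies of `A` and `B`; this is the elementary tensor `a ⊗ b`. -/
def elementaryTensor (a : A) (b : B) :
    UniversalCStarAlgebra (commutingPairPresentation A B) :=
  UniversalCStarAlgebra.gen _ (Sum.inl a) * UniversalCStarAlgebra.gen _ (Sum.inr b)

/-- The (maximal) C⋆-tensor product of `A` and `B`: the completion of the algebraic tensor product
in the norm `‖∑ aᵢ ⊗ bᵢ‖ = sup ‖∑ φ(aᵢ) ψ(bᵢ)‖`, the supremum being over all pairs of
`*`-homomorphisms `φ`, `ψ` of `A`, `B` into a C⋆-algebra with commuting ranges. It is realized as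
the closed `*`-subalgebra generated by the elementary tensors in the universal C⋆-algebra
generated by commuting copies of `A` and `B`. When `A` or `B` is nuclear (for example
commutative), this is the completion in the unique C⋆-norm on the algebraic tensor product. -/
def tensor : NonUnitalStarSubalgebra ℂ (UniversalCStarAlgebra (commutingPairPresentation A B)) :=
  (NonUnitalStarAlgebra.adjoin ℂ
    (Set.range fun p : A × B => elementaryTensor A B p.1 p.2)).topologicalClosure

instance : IsClosed
    (tensor A B : Set (UniversalCStarAlgebra (commutingPairPresentation A B))) :=
  NonUnitalStarSubalgebra.isClosed_topologicalClosure _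

end NCBall

end

open scoped ZeroAtInfty

noncomputable section

universe u

namespace NCBall

/-! ### Representations in which the centre acts by scalars -/

section CentralRepresentations

open scoped ComplexOrder

/-! The ball is the cone over the sphere in polar coordinates: `ballMap` sends `y` to the function
`t` and `w i` to `√(1 - t²) • z i`. At `t = 1` every `w i` goes to `0` and `y` to `1`, so the values
at `1` are scalars.

Injectivity rests on `y` being central. By `exists_starAlgHom_center_scalar` any nonzero element
survives in a representation `q` where the centre acts by scalars, so `y` acts by some `t` in
`[0,1]`. If `t < 1`, the elements `q (w i) / √(1 - t²)` satisfy the sphere relations; if `t = 1`,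
all `q (w i)` vanish and any character of the sphere serves. Either way `q` factors through
`ballMap` followed by evaluation at `t` (`exists_factorization`), so `ballMap` kills nothing
nonzero.

For surjectivity, the range is closed and contains all scalar functions by Stone–Weierstrass. A
closed-ideal argument in `C([0,1])` followed by Bernstein approximation gives every function
vanishing at `1` (`mem_of_generators`); constants supply the rest of the cone.

The tensor product is treated the same way: the copy of `C₀([0,1))` is central in the universal
algebra, so a representation with scalar centre evaluates it at a point. Hence `g ⊗ a ↦ g • a` is an
isomorphism onto the functions vanishing at `1`, and unitizing adds the constants. -/

/-- A contractive functional with `f 1 = 1` on a C⋆-algebra is positive. -/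
theorem nonneg_of_norm_le_one {B : Type*} [CStarAlgebra B] [PartialOrder B] [StarOrderedRing B]
    (f : B →L[ℂ] ℂ) (h1 : f 1 = 1) (hf : ‖f‖ ≤ 1) {a : B} (ha : 0 ≤ a) : 0 ≤ f a := by
  have hle (x : B) : ‖f x‖ ≤ ‖x‖ := by
    simpa using f.le_of_opNorm_le hf x
  have hsa : star a = a := (IsSelfAdjoint.of_nonneg ha).star_eq
  rw [Complex.nonneg_iff]
  constructor
  -- Since `0 ≤ a ≤ ‖a‖`, the element `‖a‖ - a` has norm at most `‖a‖`; applying `f` places `f a` in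
  -- the disc of radius `‖a‖` about `‖a‖`.
  · have h2 : ‖algebraMap ℝ B ‖a‖ - a‖ ≤ ‖a‖ := by
      have h3 : a ≤ algebraMap ℝ B ‖a‖ := IsSelfAdjoint.le_algebraMap_norm_self
      rw [CStarAlgebra.norm_le_iff_le_algebraMap _ (norm_nonneg a) (sub_nonneg.2 h3)]
      exact sub_le_self _ ha
    have h3 := (hle _).trans h2
    rw [map_sub, Algebra.algebraMap_eq_smul_one, ← Complex.coe_smul, map_smul, h1] at h3
    have h4 := (Complex.abs_re_le_norm _).trans h3
    simp only [smul_eq_mul, mul_one, Complex.sub_re, Complex.ofReal_re] at h4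
    linarith [(abs_le.1 h4).2]
  · by_contra him
    -- Compare `|f (a + is)|²` with `‖a + is‖² ≤ ‖a‖² + s²`: the `s²` terms cancel and a bound
    -- linear in `s` remains. This is absurd for large `s` of the sign of `(f a).im`.
    have key (s : ℝ) : (f a).im ^ 2 + 2 * (f a).im * s ≤ ‖a‖ ^ 2 := by
      have h2 : ‖a + (s * Complex.I) • (1 : B)‖ ^ 2 ≤ ‖a‖ ^ 2 + s ^ 2 := by
        rw [pow_two, ← CStarRing.norm_star_mul_self]
        have : star (a + (s * Complex.I) • (1 : B)) * (a + (s * Complex.I) • (1 : B)) =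
            a * a + ((s : ℂ) ^ 2) • (1 : B) := by
          simp only [star_add, hsa, star_smul, star_one, mul_add, add_mul, smul_mul_assoc,
            mul_smul_comm, one_mul, mul_one, smul_add, smul_smul]
          simp only [star_mul', Complex.star_def, Complex.conj_ofReal, Complex.conj_I]
          rw [show (s : ℂ) * Complex.I * (s * -Complex.I) = (s : ℂ) ^ 2 by
            ring_nf; simp]
          module
        rw [this]
        refine (norm_add_le _ _).trans (add_le_add ?_ ?_)
        · rw [pow_two]; exact norm_mul_le _ _
        · rw [norm_smul]
          refine (mul_le_of_le_one_right (norm_nonneg _) (PreUniversal.norm_one_le_one B)).trans ?_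
          simp
      have h3 := pow_le_pow_left₀ (norm_nonneg _) (hle (a + (s * Complex.I) • (1 : B))) 2
      rw [map_add, map_smul, h1, Complex.sq_norm, Complex.normSq_apply] at h3
      simp at h3
      nlinarith [sq_nonneg (f a).re]
    have h2 := key ((‖a‖ ^ 2 + 1) / (2 * (f a).im))
    have h3 : (f a).im ≠ 0 := fun h => him h.symm
    rw [mul_div_cancel₀ _ (mul_ne_zero two_ne_zero h3)] at h2
    nlinarith [sq_nonneg (f a).im]

/-- A nonzero element of a commutative C⋆-algebra is detected by a character. -/
theorem exists_character_ne_zero {D : Type*} [CommCStarAlgebra D] {d : D} (hd : d ≠ 0) :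
    ∃ χ : WeakDual.characterSpace ℂ D, χ d ≠ 0 := by
  by_contra! h
  refine hd ((gelfandTransform_isometry D).injective ?_)
  rw [map_zero]
  ext χ
  exact h χ

/-- Every nonzero element of a C⋆-algebra is detected by a representation in which the centre
acts by scalars. -/
theorem exists_starAlgHom_center_scalar {B : Type u} [CStarAlgebra B] {b : B} (hb : b ≠ 0) :
    ∃ (C : Type u) (_ : CStarAlgebra C) (q : B →⋆ₐ[ℂ] C), q b ≠ 0 ∧
      ∀ z ∈ Set.center B, ∃ c : ℂ, q z = algebraMap ℂ C c := by
  let _ := CStarAlgebra.spectralOrder B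
  have _ := CStarAlgebra.spectralOrderedRing B
  have hstar : ∀ z ∈ Set.center B, star z ∈ Set.center B := fun z hz => Set.star_mem_center hz
  have hcomm : ∀ z ∈ Set.center B, ∀ x, z * x = x * z := fun z hz x =>
    (Set.mem_center_iff.1 hz).comm x
  -- The centre and `star b * b` generate a commutative C⋆-algebra `D`. A character of `D` that does
  -- not vanish at `star b * b` extends to a state of `B` that is multiplicative on the centre; its
  -- GNS representation is the one sought.
  let s : Set B := insert (star b * b) (Set.center B)
  have hs : ∀ x ∈ s, ∀ y ∈ s, x * y = y * x := by
    rintro x (rfl | hx) y (rfl | hy)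
    · rfl
    · exact (hcomm y hy _).symm
    · exact hcomm x hx _
    · exact hcomm x hx _
  have hs' : ∀ x ∈ s, ∀ y ∈ s, x * star y = star y * x := by
    rintro x hx y (rfl | hy)
    · simpa using hs x hx _ (Set.mem_insert _ _)
    · exact hs x hx _ (Set.mem_insert_of_mem _ (hstar y hy))
  have hD0 : ∀ x y : StarAlgebra.adjoin ℂ s, x * y = y * x :=
    (StarAlgebra.isMulCommutative_adjoin ℂ hs hs').is_comm.comm
  let D := (StarAlgebra.adjoin ℂ s).topologicalClosure
  have hDc : IsClosed (D : Set B) := StarSubalgebra.isClosed_topologicalClosure _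
  let _ : CommCStarAlgebra D :=
    { (inferInstance : CStarAlgebra D) with
      mul_comm := ((StarAlgebra.adjoin ℂ s).commRingTopologicalClosure hD0).mul_comm }
  have hsD : s ⊆ D := (StarAlgebra.subset_adjoin ℂ s).trans
    (StarSubalgebra.le_topologicalClosure _)
  let c : D := ⟨star b * b, hsD (Set.mem_insert _ _)⟩
  have hc : c ≠ 0 := by
    intro h
    have := congrArg Subtype.val h
    exact hb (CStarRing.star_mul_self_eq_zero_iff b |>.1 this)
  obtain ⟨χ, hχ⟩ := exists_character_ne_zero hc
  let χ' : D →L[ℂ] ℂ := WeakDual.toStrongDual (χ : WeakDual ℂ D)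
  have hχ' (d : D) : χ' d = χ d := rfl
  obtain ⟨f, hf, hfn⟩ := exists_extension_norm_eq
    (StarSubalgebra.toSubalgebra D).toSubmodule χ'
  have hfD (d : D) : f d = χ d := hf d
  have hf1 : f 1 = 1 := (hfD 1).trans (map_one χ)
  have hfn1 : ‖f‖ ≤ 1 := hfn.le.trans
    ((WeakDual.CharacterSpace.norm_le_norm_one χ).trans (PreUniversal.norm_one_le_one D))
  -- The Hahn–Banach extension keeps norm at most `1` and the value `1` at the unit, which forces
  -- positivity.
  let F : B →ₚ[ℂ] ℂ := PositiveLinearMap.mk₀ f.toLinearMap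
    fun a ha => nonneg_of_norm_le_one f hf1 hfn1 ha
  have hF (x : B) : F x = f x := rfl
  have hq (x y : B) : F.gnsStarAlgHom x (F.toPreGNS y : F.GNS) = (F.toPreGNS (x * y) : F.GNS) :=
    F.gnsNonUnitalStarAlgHom_apply_coe
  have hnorm (x : B) : ((‖(F.toPreGNS x : F.GNS)‖ : ℂ)) ^ 2 = f (star x * x) := by
    rw [UniformSpace.Completion.norm_coe]
    exact F.preGNS_norm_sq (F.toPreGNS x)
  refine ⟨F.GNS →L[ℂ] F.GNS, inferInstance, F.gnsStarAlgHom, fun h0 => ?_, fun z hz => ?_⟩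
  · have h1 := hq b 1
    rw [h0, mul_one, zero_apply] at h1
    have h2 := hnorm b
    rw [← h1, norm_zero] at h2
    refine hχ ((hfD c).symm.trans (h2.symm.trans ?_))
    simp
  · have hzD : z ∈ D := hsD (Set.mem_insert_of_mem _ hz)
    -- Multiplicativity of `χ` gives `f (star h * h) = 0`, so `h` kills the cyclic vector. Being
    -- central, `h` then kills the dense subspace of all `x` applied to that vector.
    let h : D := ⟨z, hzD⟩ - algebraMap ℂ D (f z)
    have hh : (h : B) = z - algebraMap ℂ B (f z) := rfl
    have hχh : χ h = 0 := by
      rw [map_sub, AlgHomClass.commutes, ← hfD]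
      simp
    have h0 : (F.toPreGNS (h : B) : F.GNS) = 0 := by
      have h1 := hnorm (h : B)
      have h2 : f (star (h : B) * h) = χ (star h * h) := hfD (star h * h)
      rw [h2, map_mul, hχh, mul_zero] at h1
      exact norm_eq_zero.1 (Complex.ofReal_eq_zero.1 (pow_eq_zero_iff two_ne_zero |>.1 h1))
    refine ⟨f z, ContinuousLinearMap.ext fun v => ?_⟩
    refine UniformSpace.Completion.induction_on v
      (isClosed_eq (ContinuousLinearMap.continuous _) (ContinuousLinearMap.continuous _))
      fun x => ?_
    have h1 := hq (h : B) (F.ofPreGNS x)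
    have h2 : (h : B) * F.ofPreGNS x = F.ofPreGNS x * (h : B) := by
      rw [hh, sub_mul, mul_sub, hcomm z hz, Algebra.commutes]
    rw [h2, ← hq, h0, map_zero, hh, map_sub, AlgHomClass.commutes] at h1
    exact sub_eq_zero.1 h1

end CentralRepresentations

/-! ### The universal property -/

open scoped CStarAlgebra

namespace PreUniversal

variable {X : Type u} (P : Presentation X)

/-- The generators of the free `*`-algebra. -/
def var (x : X) : PreUniversal P := FreeStarAlgebra.letter (Sum.inl x)

variable {P}

@[simp]
theorem eval_var {B : Type*} [CStarAlgebra B] (f : X → B) (x : X) :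
    eval f (PreUniversal.var P x) = f x :=
  FreeStarAlgebra.eval_letter f (Sum.inl x)

theorem induction {C : PreUniversal P → Prop} (h_scalar : ∀ r : ℂ, C (algebraMap ℂ _ r))
    (h_gen : ∀ x, C (PreUniversal.var P x)) (h_star : ∀ x, C (star (PreUniversal.var P x)))
    (h_mul : ∀ a b, C a → C b → C (a * b)) (h_add : ∀ a b, C a → C b → C (a + b))
    (a : PreUniversal P) : C a := by
  refine FreeStarAlgebra.induction (C := C) h_scalar ?_ h_mul h_add a
  rintro (x | x)
  · exact h_gen x
  · have := h_star x
    rwa [show star (PreUniversal.var P x) = (FreeStarAlgebra.letter (Sum.inr x) :) from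
      FreeStarAlgebra.star_letter (Sum.inl x)] at this

end PreUniversal

namespace UniversalCStarAlgebra

open UniformSpace

variable {X : Type u} {P : Presentation X}

theorem coe_one : coe P 1 = 1 := rfl

theorem coe_var (x : X) : coe P (PreUniversal.var P x) = gen P x := rfl

theorem coe_algebraMap (r : ℂ) : coe P (algebraMap ℂ _ r) = algebraMap ℂ _ r := by
  rw [Algebra.algebraMap_eq_smul_one, coe_smul, coe_one, Algebra.algebraMap_eq_smul_one]

theorem mem_of_forall_gen_mem (S : StarSubalgebra ℂ (UniversalCStarAlgebra P))
    (hS : IsClosed (S : Set (UniversalCStarAlgebra P))) (h : ∀ x, gen P x ∈ S)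
    (a : UniversalCStarAlgebra P) : a ∈ S := by
  refine denseRange_coe.induction_on a hS fun p => ?_
  induction p using PreUniversal.induction with
  | h_scalar r => rw [coe_algebraMap]; exact S.algebraMap_mem r
  | h_gen x => exact h x
  | h_star x => rw [coe_star]; exact star_mem (h x)
  | h_mul a b ha hb => rw [coe_mul]; exact mul_mem ha hb
  | h_add a b ha hb => rw [coe_add]; exact add_mem ha hb

theorem coe_eq_eval (a : PreUniversal P) : coe P a = PreUniversal.eval (gen P) a := by
  induction a using PreUniversal.induction with
  | h_scalar r => rw [coe_algebraMap, AlgHom.commutes]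
  | h_gen x => rw [PreUniversal.eval_var, coe_var]
  | h_star x => rw [coe_star, PreUniversal.eval_star, PreUniversal.eval_var, coe_var]
  | h_mul a b ha hb => rw [coe_mul, map_mul, ha, hb]
  | h_add a b ha hb => rw [coe_add, map_add, ha, hb]

theorem hom_ext {B : Type*} [CStarAlgebra B] {f g : UniversalCStarAlgebra P →⋆ₐ[ℂ] B}
    (h : ∀ x, f (gen P x) = g (gen P x)) : f = g :=
  StarAlgHom.ext <| mem_of_forall_gen_mem (StarAlgHom.equalizer f g)
    (isClosed_eq (map_continuous f) (map_continuous g)) h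

/-- The universal norm is a supremum over admissible families, so norm bounds, and therefore
polynomial identities, that hold for all of them pass to the generators, without assuming beforehand
that the generators satisfy the relations. -/
theorem norm_eval_gen_le {a : PreUniversal P} {C : ℝ} (hC : 0 ≤ C)
    (h : ∀ (B : Type u) [CStarAlgebra B] (f : X → B), P.Holds f →
      ‖PreUniversal.eval (P := P) f a‖ ≤ C) : ‖PreUniversal.eval (P := P) (gen P) a‖ ≤ C := by
  rw [← coe_eq_eval, norm_coe]
  exact PreUniversal.supNorm_le hC h

theorem eval_gen_eq {a b : PreUniversal P}
    (h : ∀ (B : Type u) [CStarAlgebra B] (f : X → B), P.Holds f →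
      PreUniversal.eval (P := P) f a = PreUniversal.eval f b) :
    PreUniversal.eval (P := P) (gen P) a = PreUniversal.eval (gen P) b := by
  rw [← sub_eq_zero, ← map_sub, ← norm_le_zero_iff]
  exact norm_eval_gen_le le_rfl fun B _ f hf => by rw [map_sub, h B f hf, sub_self, norm_zero]

/-- The universal property of the universal C⋆-algebra. -/
def lift {B : Type u} [CStarAlgebra B] (f : X → B) (hf : P.Holds f) :
    UniversalCStarAlgebra P →⋆ₐ[ℂ] B :=
  have hc : Continuous (PreUniversal.eval (P := P) f) :=
    AddMonoidHomClass.continuous_of_bound (PreUniversal.eval (P := P) f) 1 fun a => by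
      rw [one_mul]; exact PreUniversal.le_supNorm f hf a
  let φ : UniversalCStarAlgebra P →+* B :=
    Completion.extensionHom (PreUniversal.eval (P := P) f : PreUniversal P →+* B) hc
  have hφc : Continuous φ := Completion.continuous_extension
  have hφ (a : PreUniversal P) : φ (coe P a) = PreUniversal.eval f a :=
    Completion.extensionHom_coe _ hc a
  { φ with
    commutes' := fun r => by
      change φ _ = _
      rw [← coe_algebraMap, hφ, AlgHom.commutes]
    map_star' := fun x => by
      change φ (star x) = star (φ x)
      refine denseRange_coe.induction_on x
        (isClosed_eq (hφc.comp continuous_star') (continuous_star.comp hφc)) fun a => ?_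
      rw [← coe_star, hφ, hφ, PreUniversal.eval_star] }

@[simp]
theorem lift_gen {B : Type u} [CStarAlgebra B] (f : X → B) (hf : P.Holds f) (x : X) :
    lift f hf (gen P x) = f x :=
  (Completion.extensionHom_coe (PreUniversal.eval (P := P) f : PreUniversal P →+* B)
    (AddMonoidHomClass.continuous_of_bound (PreUniversal.eval (P := P) f) 1 fun a => by
      rw [one_mul]; exact PreUniversal.le_supNorm f hf a) (PreUniversal.var P x)).trans
    (PreUniversal.eval_var f x)

end UniversalCStarAlgebra

/-! ### The relations of spheres and balls -/

section Relations

variable {m : ℕ} {θ : Matrix (Fin m) (Fin m) ℝ} {B C : Type*} [CStarAlgebra B] [CStarAlgebra C]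

theorem SphereRel.map {z : Fin m → B} (h : SphereRel θ z) (φ : B →⋆ₐ[ℂ] C) :
    SphereRel θ (φ ∘ z) where
  normal i := (h.normal i).map φ
  sum_eq_one := by simpa [map_star φ] using congrArg φ h.sum_eq_one
  mul_eq i j := by simpa using congrArg φ (h.mul_eq i j)

theorem BallRel.map {w : Fin m → B} {y : B} (h : BallRel θ w y) (φ : B →⋆ₐ[ℂ] C) :
    BallRel θ (φ ∘ w) (φ y) where
  normal i := (h.normal i).map φ
  positive := by
    obtain ⟨b, rfl⟩ := h.positive
    exact ⟨φ b, by simp [map_star φ]⟩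
  sum_eq_one := by simpa [map_star φ] using congrArg φ h.sum_eq_one
  mul_eq i j := by simpa using congrArg φ (h.mul_eq i j)
  comm i := by simpa using congrArg φ (h.comm i)

theorem BallRel.norm_le_one {w : Fin m → B} {y : B} (h : BallRel θ w y) : ‖y‖ ≤ 1 := by
  obtain ⟨b, hb⟩ := h.positive
  have hy : star y = y := by rw [hb]; simp
  refine norm_le_one_of_add_eq_one Finset.univ (fun o : Option (Fin m) => o.elim y w) ?_ none
    (Finset.mem_univ _)
  rw [Fintype.sum_option]
  simp only [Option.elim, hy]
  rw [← pow_two, add_comm]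
  exact h.sum_eq_one

/-- Positivity is not a polynomial identity; for contractions this trades it for an identity and a
norm bound, both of which pass to the universal generators. -/
theorem exists_eq_star_mul_self_iff {y : B} (hy : ‖y‖ ≤ 1) :
    (∃ b : B, y = star b * b) ↔ star y = y ∧ ‖1 - y‖ ≤ 1 := by
  let _ := CStarAlgebra.spectralOrder B
  have _ := CStarAlgebra.spectralOrderedRing B
  rw [← CStarAlgebra.nonneg_iff_eq_star_mul_self]
  constructor
  · intro h
    have h1 : y ≤ 1 := (CStarAlgebra.norm_le_one_iff_of_nonneg y h).1 hy
    exact ⟨(IsSelfAdjoint.of_nonneg h).star_eq,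
      (CStarAlgebra.norm_le_one_iff_of_nonneg _ (sub_nonneg.2 h1)).2 (sub_le_self _ h)⟩
  · rintro ⟨h1, h2⟩
    have h3 : IsSelfAdjoint (1 - y) := (IsSelfAdjoint.one B).sub h1
    have h4 : 1 - y ≤ algebraMap ℝ B ‖1 - y‖ := h3.le_algebraMap_norm_self
    have h5 : algebraMap ℝ B ‖1 - y‖ ≤ algebraMap ℝ B 1 := algebraMap_mono B h2
    simpa using h4.trans h5

open UniversalCStarAlgebra PreUniversal

/-- This lemma and its analogues below phrase the relations as equalities of evaluated polynomials,
the form that `eval_gen_eq` accepts. -/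
theorem eval_star_mul_self_eq_iff {X : Type u} {P : Presentation X} (f : X → B) (x : X) :
    eval f (star (var P x) * var P x) = eval f (var P x * star (var P x)) ↔
      IsStarNormal (f x) := by
  simp [PreUniversal.eval_star, isStarNormal_iff, commute_iff_eq]

theorem eval_mul_eq_iff {X : Type u} {P : Presentation X} (f : X → B) (c : ℂ) (x y : X) :
    eval f (var P x * var P y) = eval f (c • (var P y * var P x)) ↔
      f x * f y = c • (f y * f x) := by
  simp

theorem eval_comm_iff {X : Type u} {P : Presentation X} (f : X → B) (x y : X) :
    eval f (var P x * var P y) = eval f (var P y * var P x) ↔ f x * f y = f y * f x := by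
  simp

theorem eval_sum_eq_one_iff (f : Fin m → B) :
    eval f (∑ i, var (spherePresentation θ) i * star (var (spherePresentation θ) i)) =
      eval f (1 : PreUniversal (spherePresentation θ)) ↔ ∑ i, f i * star (f i) = 1 := by
  simp [PreUniversal.eval_star]

theorem eval_sum_add_sq_eq_one_iff (f : Option (Fin m) → B) :
    eval f (∑ i, var (ballPresentation θ) (some i) * star (var (ballPresentation θ) (some i)) +
      var (ballPresentation θ) none ^ 2) = eval f (1 : PreUniversal (ballPresentation θ)) ↔
      ∑ i, f (some i) * star (f (some i)) + f none ^ 2 = 1 := by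
  simp [PreUniversal.eval_star]

theorem eval_star_eq_iff {X : Type u} {P : Presentation X} (f : X → B) (x : X) :
    eval f (star (var P x)) = eval f (var P x) ↔ star (f x) = f x := by
  simp [PreUniversal.eval_star]

theorem eval_one_sub {X : Type u} {P : Presentation X} (f : X → B) (x : X) :
    eval f (1 - var P x) = 1 - f x := by
  simp

variable (θ) in
theorem sphereRel_gen : SphereRel θ (gen (spherePresentation θ)) where
  normal i := (eval_star_mul_self_eq_iff _ i).1 <|
    eval_gen_eq fun _ _ f hf => (eval_star_mul_self_eq_iff f i).2 (SphereRel.normal hf i)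
  sum_eq_one := (eval_sum_eq_one_iff _).1 <|
    eval_gen_eq fun _ _ f hf => (eval_sum_eq_one_iff f).2 (SphereRel.sum_eq_one hf)
  mul_eq i j := (eval_mul_eq_iff _ _ i j).1 <|
    eval_gen_eq fun _ _ f hf => (eval_mul_eq_iff f _ i j).2 (SphereRel.mul_eq hf i j)

variable (θ) in
theorem ballRel_gen : BallRel θ (fun i => gen (ballPresentation θ) (some i))
    (gen (ballPresentation θ) none) where
  normal i := (eval_star_mul_self_eq_iff _ (some i)).1 <|
    eval_gen_eq fun _ _ f hf => (eval_star_mul_self_eq_iff f (some i)).2 (BallRel.normal hf i)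
  positive := by
    have hpos {B : Type} [CStarAlgebra B] {f : Option (Fin m) → B}
        (hf : (ballPresentation θ).Holds f) : star (f none) = f none ∧ ‖1 - f none‖ ≤ 1 :=
      (exists_eq_star_mul_self_iff (BallRel.norm_le_one hf)).1 (BallRel.positive hf)
    refine (exists_eq_star_mul_self_iff ?_).2 ⟨?_, ?_⟩
    · rw [← eval_var (P := ballPresentation θ) (gen (ballPresentation θ)) none]
      exact norm_eval_gen_le zero_le_one
        fun _ _ f hf => (eval_var f none).symm ▸ BallRel.norm_le_one hf
    · exact (eval_star_eq_iff _ none).1 <|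
        eval_gen_eq fun _ _ f hf => (eval_star_eq_iff f none).2 (hpos hf).1
    · rw [← eval_one_sub (P := ballPresentation θ) (gen (ballPresentation θ)) none]
      exact norm_eval_gen_le zero_le_one
        fun _ _ f hf => (eval_one_sub f none).symm ▸ (hpos hf).2
  sum_eq_one := (eval_sum_add_sq_eq_one_iff _).1 <|
    eval_gen_eq fun _ _ f hf => (eval_sum_add_sq_eq_one_iff f).2 (BallRel.sum_eq_one hf)
  mul_eq i j := (eval_mul_eq_iff _ _ (some i) (some j)).1 <|
    eval_gen_eq fun _ _ f hf => (eval_mul_eq_iff f _ (some i) (some j)).2 (BallRel.mul_eq hf i j)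
  comm i := (eval_comm_iff _ none (some i)).1 <|
    eval_gen_eq fun _ _ f hf => (eval_comm_iff f none (some i)).2 (BallRel.comm hf i)

end Relations

/-! ### Functions on the interval vanishing at `1` -/

section Interval

open scoped unitInterval
open scoped CStarAlgebra

variable {A : Type*} [CStarAlgebra A]

/-- Evaluation at a point, as a `*`-homomorphism. -/
def evalHom (t : I) : C(I, A) →⋆ₐ[ℂ] A where
  toFun f := f t
  map_one' := rfl
  map_mul' _ _ := rfl
  map_zero' := rfl
  map_add' _ _ := rfl
  commutes' _ := rfl
  map_star' _ := rfl

@[simp]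
theorem evalHom_apply (t : I) (f : C(I, A)) : evalHom t f = f t := rfl

/-- The constant functions. -/
def constHom : A →⋆ₐ[ℂ] C(I, A) where
  toFun a := ContinuousMap.const I a
  map_one' := rfl
  map_mul' _ _ := rfl
  map_zero' := rfl
  map_add' _ _ := rfl
  commutes' _ := rfl
  map_star' _ := rfl

@[simp]
theorem constHom_apply (a : A) (t : I) : constHom a t = a := rfl

variable (A) in
/-- The scalar functions. -/
def scalarHom : C(I, ℂ) →⋆ₐ[ℂ] C(I, A) :=
  ContinuousMap.compStarAlgHom I (StarAlgHom.ofId ℂ A) (continuous_algebraMap ℂ A)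

@[simp]
theorem scalarHom_apply (g : C(I, ℂ)) (t : I) : scalarHom A g t = algebraMap ℂ A (g t) := rfl

theorem continuous_scalarHom : Continuous (scalarHom A) :=
  ContinuousMap.continuous_postcomp _

/-- The function `t ↦ g t • a`. -/
def smulConst (g : C(I, ℂ)) (a : A) : C(I, A) := scalarHom A g * constHom a

@[simp]
theorem smulConst_apply (g : C(I, ℂ)) (a : A) (t : I) : smulConst g a t = g t • a :=
  (Algebra.smul_def _ _).symm

theorem continuous_smulConst_left (a : A) : Continuous fun g => smulConst g a :=
  continuous_scalarHom.mul continuous_const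

theorem continuous_smulConst_right (g : C(I, ℂ)) : Continuous fun a : A => smulConst g a :=
  continuous_const.mul (map_continuous (constHom (A := A)))

theorem smulConst_mul_smulConst (g h : C(I, ℂ)) (a b : A) :
    smulConst g a * smulConst h b = smulConst (g * h) (a * b) := by
  ext t
  simp [smul_smul, mul_comm]

/-- A closed subspace containing all `g • a` with `g 1 = 0` contains all functions vanishing
at `1`. -/
theorem mem_of_forall_smulConst_mem (V : Submodule ℂ C(I, A)) (hV : IsClosed (V : Set C(I, A)))
    (h : ∀ (g : C(I, ℂ)) (a : A), g 1 = 0 → smulConst g a ∈ V) {f : C(I, A)} (hf : f 1 = 0) :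
    f ∈ V := by
  refine hV.mem_of_tendsto (bernsteinApproximation_uniform f)
    (Filter.eventually_atTop.2 ⟨1, fun n hn => ?_⟩)
  have hsum : bernsteinApproximation n f = ∑ k : Fin (n + 1),
      smulConst ((⟨Complex.ofReal, Complex.continuous_ofReal⟩ : C(ℝ, ℂ)).comp (bernstein n k))
        (f (bernstein.z k)) := by
    ext t
    simp [bernsteinApproximation.apply]
  rw [hsum]
  refine sum_mem fun k _ => ?_
  -- Only the last Bernstein polynomial is nonzero at `1`, and its coefficient is `f 1 = 0`; `n ≥ 1`
  -- ensures that the last node is `1`.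
  rcases eq_or_ne k (Fin.last n) with rfl | hk
  · rw [bernstein.z_last (by omega), hf]
    have : ∀ g : C(I, ℂ), smulConst g (0 : A) = 0 := fun g => by ext; simp
    rw [this]
    exact zero_mem _
  · refine h _ _ ?_
    have : n - (k : ℕ) ≠ 0 := by
      have := Fin.val_lt_last hk
      omega
    simp [bernstein_apply, this]

/-- If `h • a` is in a closed `C[0,1]`-submodule for some `h` vanishing at most at `1`, then so is
`g • a` whenever `g 1 = 0`. -/
theorem smulConst_mem_of_smulConst_mem (V : Submodule ℂ C(I, A))
    (hV : IsClosed (V : Set C(I, A))) (hmul : ∀ g, ∀ f ∈ V, scalarHom A g * f ∈ V)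
    {h : C(I, ℂ)} (hh : ∀ t, t ≠ 1 → h t ≠ 0) {a : A} (ha : smulConst h a ∈ V)
    {g : C(I, ℂ)} (hg : g 1 = 0) : smulConst g a ∈ V := by
  -- The `g` with `g • a` in `V` form a closed ideal of `C([0,1])`, which is determined by its
  -- common zeros. Since `h` belongs to it, the only possible common zero is `1`.
  let J : Ideal C(I, ℂ) :=
    { carrier := {g | smulConst g a ∈ V}
      add_mem' := fun {g g'} hg hg' => by
        have : smulConst (g + g') a = smulConst g a + smulConst g' a := by ext; simp [add_smul]
        simpa [this] using V.add_mem hg hg'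
      zero_mem' := by
        have : smulConst 0 a = 0 := by ext; simp
        simp [this]
      smul_mem' := fun g' g hg => by
        have : smulConst (g' • g) a = scalarHom A g' * smulConst g a := by
          simp [smulConst, mul_assoc]
        exact (congrArg (· ∈ V) this).mpr (hmul g' _ hg) }
  have hJ : IsClosed (J : Set C(I, ℂ)) := hV.preimage (continuous_smulConst_left a)
  have hgJ : g ∈ ContinuousMap.idealOfSet ℂ (ContinuousMap.setOfIdeal J) := by
    rw [ContinuousMap.mem_idealOfSet]
    intro t ht
    rcases eq_or_ne t 1 with rfl | h1
    · exact hg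
    · exact absurd (ContinuousMap.mem_setOfIdeal.2 ⟨h, ha, hh t h1⟩) ht
  rw [ContinuousMap.idealOfSet_ofIdeal_isClosed hJ] at hgJ
  exact hgJ

/-- The inclusion `[0,1] → ℂ`. -/
def coordinate : C(I, ℂ) := ⟨fun t => ((t : ℝ) : ℂ), by fun_prop⟩

@[simp]
theorem coordinate_apply (t : I) : coordinate t = ((t : ℝ) : ℂ) := rfl

/-- Stone–Weierstrass: the coordinate function alone separates the points of `[0,1]`. -/
theorem scalarHom_mem_of_coordinate_mem (R : StarSubalgebra ℂ C(I, A))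
    (hR : IsClosed (R : Set C(I, A))) (h : scalarHom A coordinate ∈ R) (g : C(I, ℂ)) :
    scalarHom A g ∈ R := by
  have htop := ContinuousMap.starSubalgebra_topologicalClosure_eq_top_of_separatesPoints
    (R.comap (scalarHom A)) (fun x y hxy => ⟨coordinate, ⟨coordinate, h, rfl⟩, fun h' => hxy ?_⟩)
  · have hle : (R.comap (scalarHom A)).topologicalClosure ≤ R.comap (scalarHom A) :=
      StarSubalgebra.topologicalClosure_minimal le_rfl (hR.preimage continuous_scalarHom)
    rw [htop] at hle
    exact hle (StarSubalgebra.mem_top (x := g))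
  · exact Subtype.ext (Complex.ofReal_injective h')

/-- A criterion for a closed `*`-subalgebra of `C([0,1], A)` to contain every function vanishing
at `1`. -/
theorem mem_of_generators {R : StarSubalgebra ℂ C(I, A)} (hR : IsClosed (R : Set C(I, A)))
    (hc : scalarHom A coordinate ∈ R) {s : Set A}
    (hs : ∀ S : StarSubalgebra ℂ A, IsClosed (S : Set A) → s ⊆ S → ∀ a, a ∈ S)
    {h : C(I, ℂ)} (hh : ∀ t, t ≠ 1 → h t ≠ 0) (hsR : ∀ a ∈ s, smulConst h a ∈ R)
    {f : C(I, A)} (hf : f 1 = 0) : f ∈ R := by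
  have hscalar := scalarHom_mem_of_coordinate_mem R hR hc
  have key {k : C(I, ℂ)} (hk : ∀ t, t ≠ 1 → k t ≠ 0) {a : A} (ha : smulConst k a ∈ R)
      {g : C(I, ℂ)} (hg : g 1 = 0) : smulConst g a ∈ R :=
    smulConst_mem_of_smulConst_mem R.toSubalgebra.toSubmodule hR
      (fun g f hf => R.mul_mem' (hscalar g) hf) hk ha hg
  -- A product of two functions `k • a` and `k • b` carries the weight `k * k`, which still vanishes
  -- only at `1`; `key` then replaces this weight by any `g` with `g 1 = 0`. This makes `S` closed
  -- under products.
  let k : C(I, ℂ) := 1 - coordinate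
  have hk1 : k 1 = 0 := by simp [k]
  have hk (t : I) (ht : t ≠ 1) : (k * k) t ≠ 0 := by
    have : (1 : ℂ) - (t : ℝ) ≠ 0 := by
      rw [sub_ne_zero]
      exact fun h => ht (Subtype.ext (Complex.ofReal_injective (by simpa using h.symm)))
    simpa [k] using this
  let S : StarSubalgebra ℂ A :=
    { carrier := {a | ∀ g : C(I, ℂ), g 1 = 0 → smulConst g a ∈ R}
      mul_mem' := fun {a b} ha hb g hg => by
        refine key hk ?_ hg
        rw [← smulConst_mul_smulConst]
        exact mul_mem (ha k hk1) (hb k hk1)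
      add_mem' := fun {a b} ha hb g hg => by
        have : smulConst g (a + b) = smulConst g a + smulConst g b := by ext; simp
        rw [this]
        exact add_mem (ha g hg) (hb g hg)
      algebraMap_mem' := fun c g _ => by
        have : smulConst g (algebraMap ℂ A c) = scalarHom A (c • g) := by
          ext t
          simp [Algebra.algebraMap_eq_smul_one, smul_smul, mul_comm]
        rw [this]
        exact hscalar _
      star_mem' := fun {a} ha g hg => by
        have : smulConst g (star a) = star (smulConst (star g) a) := by ext; simp
        rw [this]
        exact star_mem (ha _ (by simp [hg])) }
  have hS : IsClosed (S : Set A) := by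
    have : (S : Set A) = ⋂ (g : C(I, ℂ)) (_ : g 1 = 0), {a | smulConst g a ∈ R} := by
      ext a
      simp [S]
    rw [this]
    exact isClosed_iInter fun g => isClosed_iInter fun _ =>
      hR.preimage (continuous_smulConst_right g)
  exact mem_of_forall_smulConst_mem R.toSubalgebra.toSubmodule hR
    (fun g a hg => hs S hS (fun a ha g hg => key hh (hsR a ha) hg) a g hg) hf

end Interval

/-! ### The ball is the cone over the sphere -/

open scoped unitInterval CStarAlgebra
open UniversalCStarAlgebra

/-- The elements commuting with both `y` and `star y` form a closed `*`-subalgebra, so testing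
generators suffices. -/
theorem UniversalCStarAlgebra.mem_center {X : Type u} {P : Presentation X}
    {y : UniversalCStarAlgebra P} (h : ∀ x, Commute y (gen P x))
    (h' : ∀ x, Commute (star y) (gen P x)) : y ∈ Set.center (UniversalCStarAlgebra P) := by
  rw [Semigroup.mem_center_iff]
  intro g
  have hcl : IsClosed (StarSubalgebra.centralizer ℂ {y} : Set (UniversalCStarAlgebra P)) := by
    rw [StarSubalgebra.coe_centralizer]
    exact Set.isClosed_centralizer _
  have hg := mem_of_forall_gen_mem (StarSubalgebra.centralizer ℂ {y}) hcl
    (fun x => (StarSubalgebra.mem_centralizer_iff ℂ).2 fun z hz => by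
      rw [Set.mem_singleton_iff.1 hz]
      exact ⟨h x, h' x⟩) g
  exact ((StarSubalgebra.mem_centralizer_iff ℂ).1 hg y rfl).1.symm

section Scalars

open scoped ComplexOrder

theorem exists_unitInterval_of_algebraMap {C : Type*} [CStarAlgebra C] [Nontrivial C] {c : ℂ}
    (h : ∃ b : C, algebraMap ℂ C c = star b * b) (h1 : ‖algebraMap ℂ C c‖ ≤ 1) :
    ∃ t : I, c = ((t : ℝ) : ℂ) := by
  let _ := CStarAlgebra.spectralOrder C
  have _ := CStarAlgebra.spectralOrderedRing C
  rw [← CStarAlgebra.nonneg_iff_eq_star_mul_self] at h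
  have hc : 0 ≤ c := spectrum_nonneg_of_nonneg h (by simp [spectrum.scalar_eq])
  rw [norm_algebraMap'] at h1
  have hre := Complex.nonneg_iff.1 hc
  refine ⟨⟨c.re, hre.1, (Complex.re_le_norm c).trans h1⟩, ?_⟩
  exact Complex.ext rfl hre.2.symm

end Scalars

theorem eq_zero_of_sum_mul_star_eq_zero {B : Type*} [CStarAlgebra B] {ι : Type*} [Fintype ι]
    {a : ι → B} (h : ∑ i, a i * star (a i) = 0) (i : ι) : a i = 0 := by
  let _ := CStarAlgebra.spectralOrder B
  have _ := CStarAlgebra.spectralOrderedRing B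
  have := (Finset.sum_eq_zero_iff_of_nonneg fun j _ => mul_star_self_nonneg (a j)).1 h i
    (Finset.mem_univ i)
  exact (CStarRing.mul_star_self_eq_zero_iff _).1 this

section Ball

variable {m : ℕ} {θ : Matrix (Fin m) (Fin m) ℝ}

/-- The deformed sphere has a character, namely `z i = 1` and `z j = 0` for `j ≠ i`. -/
theorem exists_sphere_character (hm : 0 < m) (hθ : θ.transpose = -θ) :
    Nonempty (DeformedSphere θ →⋆ₐ[ℂ] ℂ) := by
  let i₀ : Fin m := ⟨0, hm⟩
  -- For the chosen point, both sides of `z i * z j = ρ j i • (z j * z i)` vanish unless `i = j =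
  -- i₀`, where skew-symmetry gives `ρ = 1`.
  have hdiag (i : Fin m) : rho θ i i = 1 := by
    have h0 : θ i i = -θ i i := congrFun (congrFun hθ i) i
    have h1 : θ i i = 0 := by linarith
    simp [rho, h1]
  refine ⟨lift (fun i => if i = i₀ then 1 else 0) ?_⟩
  refine (⟨fun i => inferInstance, ?_, fun i j => ?_⟩ :
    SphereRel θ fun i => if i = i₀ then (1 : ℂ) else 0)
  · simp
  · by_cases hi : i = i₀ <;> by_cases hj : j = i₀ <;> simp [hi, hj, hdiag]

/-- The function `t ↦ √(1 - t²)` on `[0,1]`. -/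
def radius : C(I, ℂ) := ⟨fun t => (√(1 - (t : ℝ) ^ 2) : ℝ), by fun_prop⟩

theorem radius_apply (t : I) : radius t = (√(1 - (t : ℝ) ^ 2) : ℝ) := rfl

theorem one_sub_sq_pos {t : I} (ht : t ≠ 1) : 0 < 1 - (t : ℝ) ^ 2 := by
  have h1 : (t : ℝ) < 1 := lt_of_le_of_ne t.2.2 fun h => ht (Subtype.ext h)
  nlinarith [t.2.1]

theorem radius_ne_zero {t : I} (ht : t ≠ 1) : radius t ≠ 0 := by
  rw [radius_apply, Complex.ofReal_ne_zero]
  exact (Real.sqrt_pos.2 (one_sub_sq_pos ht)).ne'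

theorem radius_one : radius 1 = 0 := by simp [radius_apply]

theorem star_radius (t : I) : star (radius t) = radius t := Complex.conj_ofReal _

theorem radius_mul_self (t : I) : radius t * radius t = 1 - ((t : ℝ) : ℂ) ^ 2 := by
  have h : 0 ≤ 1 - (t : ℝ) ^ 2 := by nlinarith [t.2.1, t.2.2]
  rw [radius_apply, ← Complex.ofReal_mul, Real.mul_self_sqrt h]
  simp

/-- Polar coordinates: the sum relation is `(1 - t²) + t² = 1`, and positivity of `t` is witnessed
by `√t`. -/
theorem SphereRel.ballRel {A : Type*} [CStarAlgebra A] {z : Fin m → A} (hz : SphereRel θ z) :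
    BallRel θ (fun i => smulConst radius (z i)) (scalarHom A coordinate) where
  normal i := ⟨by
    rw [commute_iff_eq]
    ext t
    have := (hz.normal i).star_comm_self.eq
    simp [this, star_radius]⟩
  positive := by
    refine ⟨scalarHom A ⟨fun t => (√(t : ℝ) : ℝ), by fun_prop⟩, ?_⟩
    ext t
    have : (√(t : ℝ) : ℂ) * √(t : ℝ) = ((t : ℝ) : ℂ) := by
      rw [← Complex.ofReal_mul, Real.mul_self_sqrt t.2.1]
    simp [← map_star, ← map_mul, this]
  sum_eq_one := by
    ext t
    have : ∑ i, (radius t * radius t) • (z i * star (z i)) = (1 - ((t : ℝ) : ℂ) ^ 2) • (1 : A) := by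
      rw [← Finset.smul_sum, hz.sum_eq_one, radius_mul_self]
    simp only [ContinuousMap.add_apply, ContinuousMap.coe_sum, Finset.sum_apply,
      ContinuousMap.mul_apply, ContinuousMap.star_apply, smulConst_apply, star_smul, star_radius,
      smul_mul_smul_comm, this, ContinuousMap.pow_apply, scalarHom_apply, ← map_pow,
      Algebra.algebraMap_eq_smul_one, coordinate_apply, ContinuousMap.one_apply]
    rw [← add_smul]
    simp
  mul_eq i j := by
    ext t
    simp [smul_smul, hz.mul_eq i j, mul_comm, mul_left_comm]
  comm i := by
    ext t
    simp [Algebra.commutes]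

variable (θ) in
/-- The comparison map from the ball to functions on the interval with values in the sphere. -/
def ballMap : DeformedBall θ →⋆ₐ[ℂ] C(I, DeformedSphere θ) :=
  lift (fun o => o.elim (scalarHom _ coordinate)
    fun i => smulConst radius (gen (spherePresentation θ) i)) (sphereRel_gen θ).ballRel

@[simp]
theorem ballMap_none : ballMap θ (gen _ none) = scalarHom _ coordinate := lift_gen _ _ _

@[simp]
theorem ballMap_some (i : Fin m) : ballMap θ (gen _ (some i)) =
    smulConst radius (gen (spherePresentation θ) i) := lift_gen _ _ _

theorem ball_none_mem_center : gen (ballPresentation θ) none ∈ Set.center (DeformedBall θ) := by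
  have h := ballRel_gen θ
  have hsa : star (gen (ballPresentation θ) none) = gen (ballPresentation θ) none := by
    obtain ⟨b, hb⟩ := h.positive
    rw [hb]
    simp
  have hc (o) : Commute (gen (ballPresentation θ) none) (gen (ballPresentation θ) o) := by
    cases o with
    | none => exact Commute.refl _
    | some i => exact h.comm i
  exact mem_center hc (hsa.symm ▸ hc)

/-- A representation of the ball in which `y` acts by a scalar factors through the evaluation of
`ballMap` at some point. -/
theorem exists_factorization (hm : 0 < m) (hθ : θ.transpose = -θ) {C : Type} [CStarAlgebra C]
    [Nontrivial C] (q : DeformedBall θ →⋆ₐ[ℂ] C) {c : ℂ}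
    (hc : q (gen (ballPresentation θ) none) = algebraMap ℂ C c) :
    ∃ (t : I) (τ : DeformedSphere θ →⋆ₐ[ℂ] C), q = τ.comp ((evalHom t).comp (ballMap θ)) := by
  have hrel := (ballRel_gen θ).map q
  rw [hc] at hrel
  obtain ⟨t, rfl⟩ := exists_unitInterval_of_algebraMap hrel.positive hrel.norm_le_one
  have hsum := hrel.sum_eq_one
  rw [← eq_sub_iff_add_eq, ← map_pow, ← map_one (algebraMap ℂ C), ← map_sub,
    Algebra.algebraMap_eq_smul_one] at hsum
  refine ⟨t, ?_⟩
  -- At `t = 1` the sum of the `w i * star (w i)` is `0`, so `q` is scalar-valued on generators and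
  -- factors through any character of the sphere. For `t ≠ 1`, dividing by `radius t` restores the
  -- sphere relations.
  rcases eq_or_ne t 1 with rfl | ht
  · obtain ⟨χ⟩ := exists_sphere_character hm hθ
    refine ⟨(StarAlgHom.ofId ℂ C).comp χ, hom_ext fun o => ?_⟩
    cases o with
    | none => simp [hc]
    | some i =>
      have := eq_zero_of_sum_mul_star_eq_zero (hsum.trans (by simp)) i
      simpa [radius_one] using this
  · have hr := radius_ne_zero ht
    have hz : SphereRel θ fun i => (radius t)⁻¹ • q (gen (ballPresentation θ) (some i)) :=
      { normal := fun i => by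
          have := (hrel.normal i).star_comm_self.eq
          simp only [Function.comp_apply] at this
          exact ⟨by simp only [commute_iff_eq, star_smul, smul_mul_smul_comm, this, mul_comm]⟩
        sum_eq_one := by
          simp only [Function.comp_apply] at hsum
          simp only [star_smul, star_inv₀, star_radius, smul_mul_smul_comm, ← Finset.smul_sum,
            hsum, ← radius_mul_self, smul_smul]
          rw [← mul_inv, inv_mul_cancel₀ (mul_ne_zero hr hr), one_smul]
        mul_eq := fun i j => by
          have := hrel.mul_eq i j
          simp only [Function.comp_apply] at this
          simp only [smul_mul_smul_comm, this]
          rw [smul_comm] }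
    obtain ⟨τ, hτ⟩ : ∃ τ : DeformedSphere θ →⋆ₐ[ℂ] C, ∀ i, τ (gen (spherePresentation θ) i) =
        (radius t)⁻¹ • q (gen (ballPresentation θ) (some i)) :=
      ⟨lift (P := spherePresentation θ) _ hz, lift_gen _ hz⟩
    refine ⟨τ, hom_ext fun o => ?_⟩
    cases o with
    | none => simp [hc, AlgHomClass.commutes τ]
    | some i => simp [hτ, smul_smul, hr]

theorem ballMap_injective (hm : 0 < m) (hθ : θ.transpose = -θ) :
    Function.Injective (ballMap θ) := by
  rw [injective_iff_map_eq_zero]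
  intro b hb
  by_contra hb0
  obtain ⟨C, _, q, hq, hcenter⟩ := exists_starAlgHom_center_scalar hb0
  have : Nontrivial C := ⟨_, _, hq⟩
  obtain ⟨c, hc⟩ := hcenter _ ball_none_mem_center
  obtain ⟨t, τ, rfl⟩ := exists_factorization hm hθ q hc
  exact hq (by simp [hb])

/-- Evaluation at `1` is scalar on the generators, so it agrees with its composite with a character
of the sphere; that character names the scalar. -/
theorem ballMap_mem_cone (hm : 0 < m) (hθ : θ.transpose = -θ) (b : DeformedBall θ) :
    ballMap θ b ∈ cone (DeformedSphere θ) := by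
  obtain ⟨χ⟩ := exists_sphere_character hm hθ
  let e := (evalHom 1).comp (ballMap θ)
  have h : e = (StarAlgHom.ofId ℂ _).comp (χ.comp e) := hom_ext fun o => by
    cases o with
    | none => simp [e]
    | some i => simp [e, radius_one]
  exact ⟨χ (e b), DFunLike.congr_fun h b⟩

theorem mem_range_ballMap (hm : 0 < m) (hθ : θ.transpose = -θ) {f : C(I, DeformedSphere θ)}
    (hf : f ∈ cone (DeformedSphere θ)) : f ∈ (ballMap θ).range := by
  -- An injective `*`-homomorphism of C⋆-algebras is isometric, hence has closed range.
  have hcl : IsClosed ((ballMap θ).range : Set C(I, DeformedSphere θ)) :=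
    (NonUnitalStarAlgHom.isometry (ballMap θ)
      (ballMap_injective hm hθ)).isClosedEmbedding.isClosed_range
  obtain ⟨c, hc⟩ := hf
  have hmem : f - algebraMap ℂ _ c ∈ (ballMap θ).range := by
    refine mem_of_generators hcl ⟨_, ballMap_none⟩ (s := Set.range (gen (spherePresentation θ)))
      (fun S hS hs => mem_of_forall_gen_mem S hS fun i => hs ⟨i, rfl⟩)
      (fun t => radius_ne_zero) ?_ ?_
    · rintro _ ⟨i, rfl⟩
      exact ⟨_, ballMap_some i⟩
    · simp [hc, Algebra.algebraMap_eq_smul_one]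
  simpa using add_mem hmem ((ballMap θ).range.algebraMap_mem c)

theorem nonempty_ball_equiv_cone (hm : 0 < m) (hθ : θ.transpose = -θ) :
    Nonempty (DeformedBall θ ≃⋆ₐ[ℂ] cone (DeformedSphere θ)) := by
  refine ⟨StarAlgEquiv.ofBijective
    ((ballMap θ).codRestrict (cone (DeformedSphere θ)) (ballMap_mem_cone hm hθ)) ⟨?_, ?_⟩⟩
  · intro a b h
    exact ballMap_injective hm hθ (congrArg Subtype.val h)
  · rintro ⟨f, hf⟩
    obtain ⟨b, hb⟩ := mem_range_ballMap hm hθ hf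
    exact ⟨b, Subtype.ext hb⟩

end Ball

/-! ### Functions vanishing at infinity on `[0,1)` -/

open scoped unitInterval CStarAlgebra Topology
open UniversalCStarAlgebra

section HalfOpen

/-- The inclusion `[0,1) → [0,1]`. -/
def icoInclusion : Set.Ico (0 : ℝ) 1 → I := Set.inclusion Set.Ico_subset_Icc_self

theorem range_icoInclusion : Set.range icoInclusion = {1}ᶜ := by
  ext t
  constructor
  · rintro ⟨s, rfl⟩ h
    exact s.2.2.ne (congrArg Subtype.val h)
  · intro ht
    exact ⟨⟨t, t.2.1, lt_of_le_of_ne t.2.2 fun h => ht (Subtype.ext h)⟩, rfl⟩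

theorem isOpenEmbedding_icoInclusion : Topology.IsOpenEmbedding icoInclusion :=
  ⟨Topology.IsEmbedding.inclusion Set.Ico_subset_Icc_self, range_icoInclusion ▸ isOpen_compl_singleton⟩

theorem icoInclusion_ne_one (s : Set.Ico (0 : ℝ) 1) : icoInclusion s ≠ 1 :=
  fun h => s.2.2.ne (congrArg Subtype.val h)

open Classical in
/-- Extension by zero of a function on `[0,1)`. -/
def extendFun (g : Set.Ico (0 : ℝ) 1 → ℂ) (t : I) : ℂ :=
  if h : ∃ s, icoInclusion s = t then g h.choose else 0

theorem extendFun_icoInclusion (g : Set.Ico (0 : ℝ) 1 → ℂ) (s : Set.Ico (0 : ℝ) 1) :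
    extendFun g (icoInclusion s) = g s := by
  have h : ∃ s', icoInclusion s' = icoInclusion s := ⟨s, rfl⟩
  rw [extendFun, dif_pos h]
  exact congrArg g (isOpenEmbedding_icoInclusion.injective h.choose_spec)

theorem extendFun_one (g : Set.Ico (0 : ℝ) 1 → ℂ) : extendFun g 1 = 0 :=
  dif_neg fun ⟨s, hs⟩ => icoInclusion_ne_one s hs

theorem eq_one_or_exists (t : I) : t = 1 ∨ ∃ s, icoInclusion s = t := by
  by_cases h : t = 1
  · exact Or.inl h
  · have : t ∈ Set.range icoInclusion := range_icoInclusion ▸ h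
    exact Or.inr this

theorem continuous_extendFun (g : C₀(Set.Ico (0 : ℝ) 1, ℂ)) : Continuous (extendFun g) := by
  rw [continuous_iff_continuousAt]
  intro t
  obtain rfl | ⟨s, rfl⟩ := eq_one_or_exists t
  · rw [ContinuousAt, extendFun_one, Metric.tendsto_nhds]
    intro ε hε
    obtain ⟨K, hK, hKε⟩ := Filter.mem_cocompact.1
      ((zero_at_infty g).eventually (Metric.ball_mem_nhds 0 hε))
    -- A compact subset of `[0,1)` stays closed in `[0,1]` and misses `1`, so vanishing at infinity
    -- becomes continuity at `1`.
    have hK' : (icoInclusion '' K)ᶜ ∈ 𝓝 (1 : I) :=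
      (hK.image isOpenEmbedding_icoInclusion.continuous).isClosed.isOpen_compl.mem_nhds
        fun ⟨s, _, hs⟩ => icoInclusion_ne_one s hs
    filter_upwards [hK'] with t ht
    obtain rfl | ⟨s, rfl⟩ := eq_one_or_exists t
    · rwa [extendFun_one, dist_self]
    · rw [extendFun_icoInclusion]
      exact hKε fun hs => ht ⟨s, hs, rfl⟩
  · rw [← isOpenEmbedding_icoInclusion.continuousAt_iff]
    exact (map_continuous g).continuousAt.congr
      (.of_forall fun s => (extendFun_icoInclusion g s).symm)

/-- Extension by zero, as a `*`-homomorphism `C₀([0,1)) → C([0,1])`. -/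
def extendHom : C₀(Set.Ico (0 : ℝ) 1, ℂ) →⋆ₙₐ[ℂ] C(I, ℂ) where
  toFun g := ⟨extendFun g, continuous_extendFun g⟩
  map_smul' c g := by
    ext t
    obtain rfl | ⟨s, rfl⟩ := eq_one_or_exists t <;> simp [extendFun_one, extendFun_icoInclusion]
  map_zero' := by
    ext t
    obtain rfl | ⟨s, rfl⟩ := eq_one_or_exists t <;> simp [extendFun_one, extendFun_icoInclusion]
  map_add' f g := by
    ext t
    obtain rfl | ⟨s, rfl⟩ := eq_one_or_exists t <;> simp [extendFun_one, extendFun_icoInclusion]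
  map_mul' f g := by
    ext t
    obtain rfl | ⟨s, rfl⟩ := eq_one_or_exists t <;> simp [extendFun_one, extendFun_icoInclusion]
  map_star' g := by
    ext t
    obtain rfl | ⟨s, rfl⟩ := eq_one_or_exists t <;> simp [extendFun_one, extendFun_icoInclusion]

theorem extendHom_one (g : C₀(Set.Ico (0 : ℝ) 1, ℂ)) : extendHom g 1 = 0 := extendFun_one g

theorem extendHom_icoInclusion (g : C₀(Set.Ico (0 : ℝ) 1, ℂ)) (s : Set.Ico (0 : ℝ) 1) :
    extendHom g (icoInclusion s) = g s := extendFun_icoInclusion g s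

theorem extendHom_injective : Function.Injective extendHom := fun f g h => by
  ext s
  rw [← extendHom_icoInclusion, h, extendHom_icoInclusion]

/-- Each set `{ε ≤ ‖f‖}` is compact and misses `1`, so it is compact within `[0,1)`; hence the
restriction of `f` vanishes at infinity. -/
theorem exists_extendHom_eq {f : C(I, ℂ)} (hf : f 1 = 0) : ∃ g, extendHom g = f := by
  refine ⟨⟨⟨f ∘ icoInclusion, f.continuous.comp isOpenEmbedding_icoInclusion.continuous⟩, ?_⟩, ?_⟩
  · refine Metric.tendsto_nhds.2 fun ε hε => Filter.mem_cocompact.2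
      ⟨icoInclusion ⁻¹' {t | ε ≤ ‖f t‖}, ?_, fun s hs => ?_⟩
    · refine isOpenEmbedding_icoInclusion.isInducing.isCompact_preimage' ?_ ?_
      · exact (isClosed_le continuous_const f.continuous.norm).isCompact
      · rw [range_icoInclusion]
        rintro t ht rfl
        simp only [Set.mem_ofPred_eq, hf, norm_zero] at ht
        exact ht.not_gt hε
    · simpa using hs
  · ext t
    obtain rfl | ⟨s, rfl⟩ := eq_one_or_exists t
    · rw [extendHom_one, hf]
    · exact extendHom_icoInclusion _ s

end HalfOpen

/-! ### Recognizing unitizations -/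

section Unitization

variable {T K : Type*} [NonUnitalRing T] [StarRing T] [Module ℂ T] [IsScalarTower ℂ T T]
  [SMulCommClass ℂ T T] [Ring K] [StarRing K] [Algebra ℂ K] [StarModule ℂ K]

theorem starLift_eq (j : T →⋆ₙₐ[ℂ] K) (x : Unitization ℂ T) :
    Unitization.starLift j x = algebraMap ℂ K x.fst + j x.snd := by
  rfl

theorem starLift_injective {j : T →⋆ₙₐ[ℂ] K} (hj : Function.Injective j)
    (h : ∀ (c : ℂ) x, algebraMap ℂ K c + j x = 0 → c = 0) :
    Function.Injective (Unitization.starLift j) := by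
  rw [injective_iff_map_eq_zero]
  intro x hx
  rw [starLift_eq] at hx
  have hc := h _ _ hx
  rw [hc, map_zero, zero_add, ← map_zero j] at hx
  exact Unitization.ext hc (hj hx)

/-- `C([0,1])` is the unitization of `C₀([0,1))`. -/
def unitizationEquivContinuousMap : Unitization ℂ C₀(Set.Ico (0 : ℝ) 1, ℂ) ≃⋆ₐ[ℂ] C(I, ℂ) :=
  StarAlgEquiv.ofBijective (Unitization.starLift extendHom) ⟨by
    refine starLift_injective extendHom_injective fun c x h => ?_
    simpa [extendHom_one] using DFunLike.congr_fun h 1, fun f => by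
    obtain ⟨g, hg⟩ := exists_extendHom_eq (f := f - algebraMap ℂ _ (f 1)) (by simp)
    exact ⟨Unitization.inl (f 1) + Unitization.inr g, by
      rw [starLift_eq]
      simp [hg]⟩⟩

/-- The unital extension to `C([0,1])` of a `*`-homomorphism on `C₀([0,1))`. -/
def unitalExtension (φ : C₀(Set.Ico (0 : ℝ) 1, ℂ) →⋆ₙₐ[ℂ] K) : C(I, ℂ) →⋆ₐ[ℂ] K :=
  (Unitization.starLift φ).comp
    (unitizationEquivContinuousMap.symm : C(I, ℂ) →⋆ₐ[ℂ] Unitization ℂ C₀(Set.Ico (0 : ℝ) 1, ℂ))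

theorem unitalExtension_extendHom (φ : C₀(Set.Ico (0 : ℝ) 1, ℂ) →⋆ₙₐ[ℂ] K)
    (g : C₀(Set.Ico (0 : ℝ) 1, ℂ)) : unitalExtension φ (extendHom g) = φ g := by
  have : unitizationEquivContinuousMap.symm (extendHom g) = Unitization.inr g := by
    rw [StarAlgEquiv.symm_apply_eq]
    change extendHom g = Unitization.starLift extendHom (Unitization.inr g)
    rw [starLift_eq]
    simp
  change Unitization.starLift φ (unitizationEquivContinuousMap.symm (extendHom g)) = _
  rw [this, starLift_eq]
  simp

/-- A `*`-homomorphism on `C₀([0,1))` with scalar values is the evaluation at some point. -/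
theorem exists_point_of_scalar [Nontrivial K] (φ : C₀(Set.Ico (0 : ℝ) 1, ℂ) →⋆ₙₐ[ℂ] K)
    (h : ∀ g, ∃ c : ℂ, φ g = algebraMap ℂ K c) :
    ∃ t : I, ∀ g, φ g = algebraMap ℂ K (extendHom g t) := by
  let Φ := unitalExtension φ
  have hΦ (f : C(I, ℂ)) : ∃ c : ℂ, Φ f = algebraMap ℂ K c := by
    obtain ⟨g, hg⟩ := exists_extendHom_eq (f := f - algebraMap ℂ _ (f 1)) (by simp)
    obtain ⟨c, hc⟩ := h g
    refine ⟨c + f 1, ?_⟩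
    rw [map_add, ← hc, ← unitalExtension_extendHom, hg, ← AlgHomClass.commutes Φ, ← map_add,
      sub_add_cancel]
  -- A proper ideal has proper closure, hence a common zero `t`. If `Φ f = c`, then `f - c` lies in
  -- the kernel, so `f t = c`. The point `t = 1` accounts for `φ = 0`.
  let J := RingHom.ker Φ
  obtain ⟨t, ht⟩ : ∃ t, t ∉ ContinuousMap.setOfIdeal J := by
    by_contra! hJ
    have h1 : (1 : C(I, ℂ)) ∈ J.closure := by
      rw [← ContinuousMap.idealOfSet_ofIdeal_eq_closure, ContinuousMap.mem_idealOfSet]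
      exact fun t ht => absurd (hJ t) ht
    have htop : J.closure ≠ ⊤ := Ideal.closure_ne_top J (RingHom.ker_ne_top _)
    exact htop ((Ideal.eq_top_iff_one _).2 h1)
  rw [ContinuousMap.notMem_setOfIdeal] at ht
  refine ⟨t, fun g => ?_⟩
  obtain ⟨c, hc⟩ := hΦ (extendHom g)
  have hmem : extendHom g - algebraMap ℂ _ c ∈ J := by
    rw [RingHom.mem_ker, map_sub, hc, AlgHomClass.commutes, sub_self]
  have := ht hmem
  rw [ContinuousMap.sub_apply, sub_eq_zero] at this
  rw [this, ← unitalExtension_extendHom]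
  exact hc

end Unitization

/-! ### The tensor product of `C₀([0,1))` with a unital C⋆-algebra -/

open scoped unitInterval CStarAlgebra Topology
open UniversalCStarAlgebra

section CommutingPairs

variable (A B : Type u) [NonUnitalCStarAlgebra A] [NonUnitalCStarAlgebra B]

open PreUniversal

section Eval

variable {X : Type u} {P : Presentation X} {C : Type*} [CStarAlgebra C] (f : X → C)

theorem eval_smul_var_iff (c : ℂ) (x y : X) :
    eval f (var P x) = eval f (c • var P y) ↔ f x = c • f y := by simp

theorem eval_zero_iff (x : X) :
    eval f (var P x) = eval f (0 : PreUniversal P) ↔ f x = 0 := by simp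

theorem eval_add_var_iff (x y z : X) :
    eval f (var P x) = eval f (var P y + var P z) ↔ f x = f y + f z := by simp

theorem eval_mul_var_iff (x y z : X) :
    eval f (var P x) = eval f (var P y * var P z) ↔ f x = f y * f z := by simp

theorem eval_star_var_iff (x y : X) :
    eval f (var P x) = eval f (star (var P y)) ↔ f x = star (f y) := by
  simp [PreUniversal.eval_star]

end Eval

/-- The canonical copy of the first factor. -/
def tensorLeft : A →⋆ₙₐ[ℂ] UniversalCStarAlgebra (commutingPairPresentation A B) where
  toFun a := gen _ (Sum.inl a)
  map_smul' c a := (eval_smul_var_iff _ c _ _).1 <| eval_gen_eq fun _ _ f hf => by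
    obtain ⟨φ, ψ, -, rfl⟩ := hf
    exact (eval_smul_var_iff _ _ _ _).2 (map_smul φ c a)
  map_zero' := (eval_zero_iff _ _).1 <| eval_gen_eq fun _ _ f hf => by
    obtain ⟨φ, ψ, -, rfl⟩ := hf
    exact (eval_zero_iff _ _).2 (map_zero φ)
  map_add' a b := (eval_add_var_iff _ _ _ _).1 <| eval_gen_eq fun _ _ f hf => by
    obtain ⟨φ, ψ, -, rfl⟩ := hf
    exact (eval_add_var_iff _ _ _ _).2 (map_add φ a b)
  map_mul' a b := (eval_mul_var_iff _ _ _ _).1 <| eval_gen_eq fun _ _ f hf => by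
    obtain ⟨φ, ψ, -, rfl⟩ := hf
    exact (eval_mul_var_iff _ _ _ _).2 (map_mul φ a b)
  map_star' a := (eval_star_var_iff _ _ _).1 <| eval_gen_eq fun _ _ f hf => by
    obtain ⟨φ, ψ, -, rfl⟩ := hf
    exact (eval_star_var_iff _ _ _).2 (map_star φ a)

/-- The canonical copy of the second factor. -/
def tensorRight : B →⋆ₙₐ[ℂ] UniversalCStarAlgebra (commutingPairPresentation A B) where
  toFun b := gen _ (Sum.inr b)
  map_smul' c a := (eval_smul_var_iff _ c _ _).1 <| eval_gen_eq fun _ _ f hf => by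
    obtain ⟨φ, ψ, -, rfl⟩ := hf
    exact (eval_smul_var_iff _ _ _ _).2 (map_smul ψ c a)
  map_zero' := (eval_zero_iff _ _).1 <| eval_gen_eq fun _ _ f hf => by
    obtain ⟨φ, ψ, -, rfl⟩ := hf
    exact (eval_zero_iff _ _).2 (map_zero ψ)
  map_add' a b := (eval_add_var_iff _ _ _ _).1 <| eval_gen_eq fun _ _ f hf => by
    obtain ⟨φ, ψ, -, rfl⟩ := hf
    exact (eval_add_var_iff _ _ _ _).2 (map_add ψ a b)
  map_mul' a b := (eval_mul_var_iff _ _ _ _).1 <| eval_gen_eq fun _ _ f hf => by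
    obtain ⟨φ, ψ, -, rfl⟩ := hf
    exact (eval_mul_var_iff _ _ _ _).2 (map_mul ψ a b)
  map_star' a := (eval_star_var_iff _ _ _).1 <| eval_gen_eq fun _ _ f hf => by
    obtain ⟨φ, ψ, -, rfl⟩ := hf
    exact (eval_star_var_iff _ _ _).2 (map_star ψ a)

variable {A B}

theorem commute_tensorLeft_tensorRight (a : A) (b : B) :
    Commute (tensorLeft A B a) (tensorRight A B b) :=
  (eval_comm_iff _ (Sum.inl a) (Sum.inr b)).1 <| eval_gen_eq fun _ _ f hf => by
    obtain ⟨φ, ψ, h, rfl⟩ := hf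
    exact (eval_comm_iff _ _ _).2 (h a b)

theorem elementaryTensor_eq (a : A) (b : B) :
    elementaryTensor A B a b = tensorLeft A B a * tensorRight A B b := rfl

theorem tensorLeft_mem_center (h : ∀ a a' : A, Commute a a') (a : A) :
    tensorLeft A B a ∈ Set.center (UniversalCStarAlgebra (commutingPairPresentation A B)) := by
  have hc (a : A) (x : A ⊕ B) :
      Commute (tensorLeft A B a) (gen (commutingPairPresentation A B) x) := by
    rcases x with a' | b
    · exact (h a a').map (tensorLeft A B)
    · exact commute_tensorLeft_tensorRight a b
  refine mem_center (hc a) ?_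
  rw [← map_star]
  exact hc _

theorem elementaryTensor_mem_tensor (a : A) (b : B) : elementaryTensor A B a b ∈ tensor A B :=
  NonUnitalStarSubalgebra.le_topologicalClosure _
    (NonUnitalStarAlgebra.subset_adjoin ℂ _ ⟨(a, b), rfl⟩)

theorem tensor_eqOn {C : Type*} [NonUnitalCStarAlgebra C]
    {f g : UniversalCStarAlgebra (commutingPairPresentation A B) →⋆ₙₐ[ℂ] C}
    (h : ∀ a b, f (elementaryTensor A B a b) = g (elementaryTensor A B a b)) :
    ∀ x ∈ tensor A B, f x = g x := by
  have hle : tensor A B ≤ NonUnitalStarAlgHom.equalizer f g := by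
    refine NonUnitalStarSubalgebra.topologicalClosure_minimal _
      (NonUnitalStarAlgebra.adjoin_le ?_) (isClosed_eq (map_continuous f) (map_continuous g))
    rintro _ ⟨⟨a, b⟩, rfl⟩
    exact h a b
  exact fun x hx => hle hx

end CommutingPairs

section Cone

variable (A : Type) [CStarAlgebra A]

/-- The comparison map from the universal algebra to functions on the interval. -/
def commutingPairMap :
    UniversalCStarAlgebra (commutingPairPresentation C₀(Set.Ico (0 : ℝ) 1, ℂ) A) →⋆ₐ[ℂ] C(I, A) :=
  lift (Sum.elim (fun g => scalarHom A (extendHom g)) constHom)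
    ⟨(scalarHom A).toNonUnitalStarAlgHom.comp extendHom, constHom.toNonUnitalStarAlgHom,
      fun g a => by
        rw [commute_iff_eq]
        ext t
        exact Algebra.commutes _ _, rfl⟩

variable {A}

theorem commutingPairMap_tensorLeft (g : C₀(Set.Ico (0 : ℝ) 1, ℂ)) :
    commutingPairMap A (tensorLeft _ _ g) = scalarHom A (extendHom g) := lift_gen _ _ _

theorem commutingPairMap_tensorRight (a : A) :
    commutingPairMap A (tensorRight _ _ a) = constHom a := lift_gen _ _ _

theorem commutingPairMap_elementaryTensor (g : C₀(Set.Ico (0 : ℝ) 1, ℂ)) (a : A) :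
    commutingPairMap A (elementaryTensor _ _ g a) = smulConst (extendHom g) a := by
  rw [elementaryTensor_eq, map_mul, commutingPairMap_tensorLeft, commutingPairMap_tensorRight,
    smulConst]

variable (A) in
/-- The comparison map from `C₀([0,1)) ⊗ A` to functions on the interval. -/
def tensorMap : tensor C₀(Set.Ico (0 : ℝ) 1, ℂ) A →⋆ₙₐ[ℂ] C(I, A) :=
  (commutingPairMap A).toNonUnitalStarAlgHom.comp (NonUnitalStarSubalgebraClass.subtype _)

theorem tensorMap_apply (x : tensor C₀(Set.Ico (0 : ℝ) 1, ℂ) A) :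
    tensorMap A x = commutingPairMap A x := rfl

theorem tensorMap_apply_one (x : tensor C₀(Set.Ico (0 : ℝ) 1, ℂ) A) : tensorMap A x 1 = 0 :=
  tensor_eqOn (f := ((evalHom 1).comp (commutingPairMap A)).toNonUnitalStarAlgHom) (g := 0)
    (fun g a => by simp [commutingPairMap_elementaryTensor, extendHom_one]) x x.2

/-- When the centre acts by scalars, `q` evaluates the central copy of `C₀([0,1))` at a point `t`.
On elementary tensors, and so on their closed span, `q` equals evaluation at `t` followed by `q` on
the copy of `A`. The latter need not be unital, whence the non-unital homomorphisms. -/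
theorem tensorMap_injective : Function.Injective (tensorMap A) := by
  rw [injective_iff_map_eq_zero]
  intro x hx
  by_contra hx0
  obtain ⟨C, _, q, hq, hcenter⟩ :=
    exists_starAlgHom_center_scalar (b := x.1) fun h => hx0 (Subtype.ext h)
  have : Nontrivial C := ⟨_, _, hq⟩
  obtain ⟨t, ht⟩ := exists_point_of_scalar (q.toNonUnitalStarAlgHom.comp (tensorLeft _ A))
    fun g => hcenter _ (tensorLeft_mem_center (fun a a' => ZeroAtInftyContinuousMap.ext fun s => mul_comm (a s) (a' s)) g)
  have h := tensor_eqOn (f := q.toNonUnitalStarAlgHom)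
    (g := (q.toNonUnitalStarAlgHom.comp (tensorRight _ A)).comp
      ((evalHom t).comp (commutingPairMap A)).toNonUnitalStarAlgHom) (fun g a => by
        have htg : q (tensorLeft _ A g) = algebraMap ℂ C (extendHom g t) := ht g
        have hl : q (elementaryTensor _ A g a) = extendHom g t • q (tensorRight _ A a) := by
          rw [elementaryTensor_eq, map_mul, htg, Algebra.smul_def]
        simpa [commutingPairMap_elementaryTensor] using hl) x x.2
  refine hq (h.trans ?_)
  rw [tensorMap_apply] at hx
  simp [hx]

/-- Elementary tensors already reach every `g • a` with `g 1 = 0`; these span a dense subspace and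
the range is closed. -/
theorem exists_tensorMap_eq {f : C(I, A)} (hf : f 1 = 0) : ∃ x, tensorMap A x = f := by
  have hcl : IsClosed ((NonUnitalStarAlgHom.range (tensorMap A)).toNonUnitalSubalgebra.toSubmodule :
      Set C(I, A)) :=
    (NonUnitalStarAlgHom.isometry (tensorMap A)
      tensorMap_injective).isClosedEmbedding.isClosed_range
  refine mem_of_forall_smulConst_mem _ hcl (fun g a hg => ?_) hf
  obtain ⟨g, rfl⟩ := exists_extendHom_eq hg
  exact ⟨⟨_, elementaryTensor_mem_tensor g a⟩, commutingPairMap_elementaryTensor g a⟩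

/-- Evaluation at `1` recovers the scalar part, since functions in the image of `tensorMap` vanish
there. Nontriviality of `A` makes that scalar unique. -/
theorem nonempty_cone_equiv_unitization [Nontrivial A] :
    Nonempty (cone A ≃⋆ₐ[ℂ] Unitization ℂ (tensor C₀(Set.Ico (0 : ℝ) 1, ℂ) A)) := by
  have hmem (x) : Unitization.starLift (tensorMap A) x ∈ cone A :=
    ⟨x.fst, by
      rw [starLift_eq]
      simp [tensorMap_apply_one, Algebra.algebraMap_eq_smul_one]⟩
  refine ⟨(StarAlgEquiv.ofBijective
    ((Unitization.starLift (tensorMap A)).codRestrict (cone A) hmem) ⟨?_, ?_⟩).symm⟩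
  · intro x y h
    refine starLift_injective tensorMap_injective (fun c x h => ?_) (congrArg Subtype.val h)
    simpa [tensorMap_apply_one] using DFunLike.congr_fun h 1
  · rintro ⟨f, c, hc⟩
    obtain ⟨x, hx⟩ := exists_tensorMap_eq (f := f - algebraMap ℂ _ c)
      (by simp [hc, Algebra.algebraMap_eq_smul_one])
    refine ⟨Unitization.inl c + Unitization.inr x, Subtype.ext ?_⟩
    exact (starLift_eq _ _).trans (by simp [hx])

end Cone

end NCBall

theorem corollary1p8 (m : ℕ) (hm : 2 ≤ m) (θ : Matrix (Fin m) (Fin m) ℝ)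
    (hθ : θ.transpose = -θ) :
    Nonempty (NCBall.DeformedBall θ ≃⋆ₐ[ℂ] NCBall.cone (NCBall.DeformedSphere θ)) ∧
    Nonempty (NCBall.cone (NCBall.DeformedSphere θ) ≃⋆ₐ[ℂ]
      Unitization ℂ (NCBall.tensor C₀(Set.Ico (0 : ℝ) 1, ℂ) (NCBall.DeformedSphere θ))) := by
  have hm' : 0 < m := by omega
  obtain ⟨χ⟩ := NCBall.exists_sphere_character hm' hθ
  have : Nontrivial (NCBall.DeformedSphere θ) := χ.toRingHom.domain_nontrivial
  exact ⟨NCBall.nonempty_ball_equiv_cone hm' hθ, NCBall.nonempty_cone_equiv_unitization⟩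
end
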